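/- Let $I$ be an index set and let $(A_v,p_v)_{v\in I}$ and $(A'_v,p'_v)_{v\in I}$ be families of $C^*$-algebras with distinguished projections such that $p_v\neq 0$ and $p'_v\neq 0$ for all but finitely many $v$. Let $A=\bigotimes'_v(A_v,p_v)$ and $A'=\bigotimes'_v(A'_v,p'_v)$ be the restricted (spatial) tensor products, i.e. the $C^*$-inductive limits of the spatial tensor products over finite sets of indices along $a\mapsto a\otimes p_v$ (resp. $a'\mapsto a'\otimes p'_v$). For each $v$ let $X_v$ be a right Hilbert $C^*$-module over $A_v$ and $x_v\in X_v$, with $\langle x_v,x_v\rangle=p_v$ for all but finitely many $v$. Let $X=\bigotimes'_v(X_v,x_v)$ be the right Hilbert $A$-module obtained by completing the span of the simple tensors $\otimes_v w_v$ ($w_v\in X_v$, $w_v=x_v$ for all but finitely many $v$) with respect to the inner product $\langle\otimes_v w_v,\otimes_v z_v\rangle=\otimes_v\langle w_v,z_v\rangle\in A$. Let $\alpha_v:A'_v\to\mathrm{End}^*_{A_v}(X_v)$ be $*$-homomorphisms into the adjointable operators such that $\alpha_v(p'_v)x_v=x_v$ for all but finitely many $v$. (1) There is a unique $*$-homomorphism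 $\alpha:A'\to\mathrm{End}^*_A(X)$ with $$\alpha(\otimes_v a'_v)(\otimes_v w_v)=\otimes_v\,\alpha_v(a'_v)(w_v)$$ for all simple tensors $\otimes_v a'_v\in A'$ ($a'_v=p'_v$ for all but finitely many $v$) and $\otimes_v w_v\in X$. Thus $X$ is an $(A',A)$-correspondence. (2) Let $\pi_v:A_v\to\mathbb B(\mathcal H_v)$ be representations on Hilbert spaces and $h_v\in\mathcal H_v$ vectors which, for all but finitely many $v$, are unit vectors with $\pi_v(p_v)h_v=h_v$, and let $(\pi,\mathcal H)$ be a representation of $A$ that is unitarily equivalent to $\bigl(\bigotimes'_v\pi_v,\bigotimes'_v(\mathcal H_v,h_v)\bigr)$; use a unitary equivalence to identify $\mathcal H$ with $\bigotimes'_v(\mathcal H_v,h_v)$. Then there is a unique unitary isomorphism $$X\otimes_A\mathcal H\;\cong\;\bigotimes\nolimits'_v\bigl(X_v\otimes_{A_v}\mathcal H_v,\;x_v\otimes h_v\bigr),\qquad (\otimes_v w_v)\otimes(\otimes_v y_v)\mapsto\otimes_v(w_v\otimes y_v),$$ and it intertwines the two representations of $A'$: the one on $X\otimes_A\mathcal H$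 given by $a'\mapsto\alpha(a')\otimes 1$, and the restricted tensor product, on the right-hand side, of the representations $a'_v\mapsto\alpha_v(a'_v)\otimes 1$ of $A'_v$ on $X_v\otimes_{A_v}\mathcal H_v$. -/

import Mathlib

noncomputable section

namespace RTensor

open Filter UniformSpace
open scoped InnerProductSpace ComplexOrder

universe u w

/-! ### Hilbert spaces generated by positive semidefinite kernels -/

section Kernel

variable {S S' : Type*}

/-- Positive semidefinite complex kernels on a set `S`. -/
structure IsPSDKernel (K : S → S → ℂ) : Prop where
  conj_symm : ∀ s t, star (K t s) = K s t
  re_nonneg : ∀ f : S →₀ ℂ, 0 ≤ (f.sum fun s c ↦ f.sum fun t d ↦ star c * K s t * d).re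

variable {K : S → S → ℂ} {hK : IsPSDKernel K} {K' : S' → S' → ℂ} {hK' : IsPSDKernel K'}

/-- The semi-inner product `⟪∑ cₛ δₛ, ∑ dₜ δₜ⟫ = ∑ conj cₛ dₜ K(s, t)` on the free complex vector
space on `S`, for a positive semidefinite kernel `K`. -/
abbrev kernelCore (hK : IsPSDKernel K) : PreInnerProductSpace.Core ℂ (S →₀ ℂ) where
  inner f g := f.sum fun s c ↦ g.sum fun t d ↦ star c * K s t * d
  conj_inner_symm f g := by
    rw [Finsupp.sum_comm]
    simp only [map_finsuppSum]
    congr 1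
    funext s c
    congr 1
    funext t d
    rw [← hK.conj_symm s t]
    simp [mul_comm, mul_left_comm]
  re_inner_nonneg f := hK.re_nonneg f
  add_left f g h := by
    rw [Finsupp.sum_add_index'] <;> simp [← Finsupp.sum_add, add_mul]
  smul_left f g r := by
    rw [Finsupp.sum_smul_index] <;> simp [Finsupp.mul_sum, ← mul_assoc]

/-- The free complex vector space on `S`, equipped with the semi-inner product determined by
the positive semidefinite kernel `K`. -/
def KernelPre (K : S → S → ℂ) (_hK : IsPSDKernel K) : Type _ := S →₀ ℂ

instance : AddCommGroup (KernelPre K hK) := inferInstanceAs (AddCommGroup (S →₀ ℂ))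
instance : Module ℂ (KernelPre K hK) := inferInstanceAs (Module ℂ (S →₀ ℂ))

/-- The semi-inner product on `KernelPre K hK`. -/
abbrev KernelPre.core (hK : IsPSDKernel K) : PreInnerProductSpace.Core ℂ (KernelPre K hK) where
  inner := (kernelCore hK).inner
  conj_inner_symm := (kernelCore hK).conj_inner_symm
  re_inner_nonneg := (kernelCore hK).re_inner_nonneg
  add_left := (kernelCore hK).add_left
  smul_left := (kernelCore hK).smul_left

instance : SeminormedAddCommGroup (KernelPre K hK) :=
  InnerProductSpace.Core.toSeminormedAddCommGroup (c := KernelPre.core hK)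
instance : InnerProductSpace ℂ (KernelPre K hK) := InnerProductSpace.ofCore (KernelPre.core hK)

/-- The basis vector `δₛ`. -/
def KernelPre.single (K : S → S → ℂ) (hK : IsPSDKernel K) (s : S) : KernelPre K hK :=
  Finsupp.single s (1 : ℂ)

lemma KernelPre.inner_single (s t : S) :
    ⟪KernelPre.single K hK s, KernelPre.single K hK t⟫_ℂ = K s t := by
  change (kernelCore hK).inner (Finsupp.single s (1 : ℂ)) (Finsupp.single t (1 : ℂ)) = K s t
  change ((Finsupp.single s (1 : ℂ)).sum fun s c ↦
    (Finsupp.single t (1 : ℂ)).sum fun t d ↦ star c * K s t * d) = K s t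
  simp

lemma KernelPre.induction {P : KernelPre K hK → Prop} (f : KernelPre K hK)
    (h0 : P 0) (h1 : ∀ s, P (KernelPre.single K hK s)) (ha : ∀ f g, P f → P g → P (f + g))
    (hs : ∀ (c : ℂ) f, P f → P (c • f)) : P f := by
  refine Finsupp.induction_linear (motive := P) f h0 ha fun s c ↦ ?_
  have := hs c _ (h1 s)
  have h : c • KernelPre.single K hK s = (Finsupp.single s c : S →₀ ℂ) := by
    change c • (Finsupp.single s (1 : ℂ)) = Finsupp.single s c
    simp
  exact h ▸ this

/-- The Hilbert space generated by the kernel `K`: the (Hausdorff) completion of the free vector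
space on `S` in the semi-inner product given by `K`. -/
def KernelSpace (K : S → S → ℂ) (hK : IsPSDKernel K) : Type _ := Completion (KernelPre K hK)

instance : NormedAddCommGroup (KernelSpace K hK) :=
  inferInstanceAs (NormedAddCommGroup (Completion (KernelPre K hK)))
instance : InnerProductSpace ℂ (KernelSpace K hK) :=
  inferInstanceAs (InnerProductSpace ℂ (Completion (KernelPre K hK)))
instance : CompleteSpace (KernelSpace K hK) :=
  inferInstanceAs (CompleteSpace (Completion (KernelPre K hK)))

/-- The canonical map `S → KernelSpace K`, whose Gram kernel is `K`. -/
def KernelSpace.mk (K : S → S → ℂ) (hK : IsPSDKernel K) (s : S) : KernelSpace K hK :=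
  ((KernelPre.single K hK s : KernelPre K hK) : Completion (KernelPre K hK))

lemma KernelSpace.inner_mk (s t : S) :
    ⟪KernelSpace.mk K hK s, KernelSpace.mk K hK t⟫_ℂ = K s t :=
  (Completion.inner_coe _ _).trans (KernelPre.inner_single s t)

lemma KernelSpace.norm_mk_sq (s : S) : ‖KernelSpace.mk K hK s‖ ^ 2 = (K s s).re := by
  rw [← KernelSpace.inner_mk (hK := hK), ← inner_self_eq_norm_sq (𝕜 := ℂ)]; rfl

lemma KernelSpace.induction {P : KernelSpace K hK → Prop} (f : KernelSpace K hK)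
    (hc : IsClosed {f | P f})
    (h0 : P 0) (h1 : ∀ s, P (KernelSpace.mk K hK s)) (ha : ∀ f g, P f → P g → P (f + g))
    (hs : ∀ (c : ℂ) f, P f → P (c • f)) : P f := by
  refine Completion.induction_on (p := P) f hc fun f ↦ ?_
  refine KernelPre.induction (P := fun f ↦ P (f : Completion (KernelPre K hK))) f h0 h1 ?_ ?_
  · intro f g hf hg
    rw [Completion.coe_add]; exact ha _ _ hf hg
  · intro c f hf
    rw [Completion.coe_smul]; exact hs _ _ hf

lemma KernelSpace.clm_ext {E : Type*} [NormedAddCommGroup E] [NormedSpace ℂ E]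
    {T T' : KernelSpace K hK →L[ℂ] E}
    (h : ∀ s, T (KernelSpace.mk K hK s) = T' (KernelSpace.mk K hK s)) : T = T' := by
  ext f
  refine KernelSpace.induction (P := fun f ↦ T f = T' f) f
    (isClosed_eq T.continuous T'.continuous) (by simp) h ?_ ?_
  · intro f g hf hg; simp [hf, hg]
  · intro c f hf; simp [hf]

/-- If `T` has formal adjoint `R` and the powers of `R T` grow at most like `C Mⁿ` on each vector,
then `‖T x‖² ≤ M ‖x‖²`. -/
lemma norm_sq_le_of_growth {E F : Type*} [SeminormedAddCommGroup E] [InnerProductSpace ℂ E]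
    [SeminormedAddCommGroup F] [InnerProductSpace ℂ F] (T : E →ₗ[ℂ] F) (R : F →ₗ[ℂ] E)
    (hTR : ∀ x y, ⟪T x, y⟫_ℂ = ⟪x, R y⟫_ℂ) (M : ℝ) (hM : 0 ≤ M) (x : E)
    (hb : ∃ C : ℝ, ∀ n : ℕ, ‖(fun z ↦ R (T z))^[n] x‖ ≤ C * M ^ n) :
    ‖T x‖ ^ 2 ≤ M * ‖x‖ ^ 2 := by
  set L : E → E := fun z ↦ R (T z) with hL
  have hRT : ∀ x y, ⟪R x, y⟫_ℂ = ⟪x, T y⟫_ℂ := fun x y ↦ by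
    rw [← inner_conj_symm, ← hTR, inner_conj_symm]
  have hsym : ∀ x y, ⟪L x, y⟫_ℂ = ⟪x, L y⟫_ℂ := fun x y ↦ by simp only [hL, hRT, hTR]
  have hT : ‖T x‖ ^ 2 ≤ ‖x‖ * ‖L x‖ := by
    rw [← inner_self_eq_norm_sq (𝕜 := ℂ), hTR]
    exact (RCLike.re_le_norm _).trans (norm_inner_le_norm _ _)
  set r : ℕ → ℝ := fun n ↦ ‖L^[n] x‖ with hr
  have hlog : ∀ n, r (n + 1) ^ 2 ≤ r n * r (n + 2) := fun n ↦ by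
    simp only [hr]
    rw [← inner_self_eq_norm_sq (𝕜 := ℂ)]
    conv_lhs => rw [Function.iterate_succ_apply', hsym, ← Function.iterate_succ_apply' L,
      ← Function.iterate_succ_apply' L]
    exact (RCLike.re_le_norm _).trans (norm_inner_le_norm _ _)
  suffices h : ‖L x‖ ≤ M * ‖x‖ by
    calc _ ≤ _ := hT
      _ ≤ ‖x‖ * (M * ‖x‖) := by gcongr
      _ = _ := by ring
  by_contra! hlt
  obtain ⟨C, hC⟩ := hb
  have h0 : 0 < ‖x‖ := by
    by_contra! h0
    have h0 : ‖x‖ = 0 := le_antisymm h0 (norm_nonneg _)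
    have := hlog 0
    simp only [hr, Function.iterate_zero, id, h0, zero_mul, zero_add, Function.iterate_one] at this
    rw [h0, mul_zero] at hlt
    nlinarith
  set q : ℝ := r 1 / r 0 with hq
  have hr0 : 0 < r 0 := h0
  have hqM : M < q := by rw [hq, lt_div_iff₀ hr0]; exact hlt
  have hq0 : 0 < q := hM.trans_lt hqM
  have hstep : ∀ n, 0 < r n ∧ q * r n ≤ r (n + 1) := by
    intro n
    induction n with
    | zero => exact ⟨hr0, by rw [hq, div_mul_cancel₀ _ hr0.ne']⟩
    | succ n ih =>
      have h1 : 0 < r (n + 1) := (mul_pos hq0 ih.1).trans_le ih.2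
      refine ⟨h1, ?_⟩
      have := hlog n
      have h2 : q * r n * r (n + 1) ≤ r n * r (n + 2) := by nlinarith
      have h3 : r n * (q * r (n + 1)) ≤ r n * r (n + 2) := by linarith
      exact le_of_mul_le_mul_left h3 ih.1
  have hgrow : ∀ n, q ^ n * r 0 ≤ r n := by
    intro n
    induction n with
    | zero => simp
    | succ n ih =>
      calc q ^ (n + 1) * r 0 = q * (q ^ n * r 0) := by ring
        _ ≤ q * r n := by gcongr
        _ ≤ _ := (hstep n).2
  rcases hM.eq_or_lt with h | h
  · have := (hgrow 1).trans (hC 1)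
    rw [← h] at this
    simp at this
    nlinarith
  · have hq1 : 1 < q / M := by rwa [one_lt_div h]
    obtain ⟨n, hn⟩ := pow_unbounded_of_one_lt (C / r 0) hq1
    have := (hgrow n).trans (hC n)
    rw [div_pow, div_lt_div_iff₀ hr0 (pow_pos h n)] at hn
    linarith

/-- Boundedness criterion for operators between kernel spaces given on the generators by a pair of
formally adjoint maps. -/
lemma KernelSpace.exists_map (f : S → S') (g : S' → S) (hfg : ∀ s t, K' (f s) t = K s (g t))
    (M : ℝ) (hM : 0 ≤ M)
    (hb : ∀ s, ∃ C : ℝ, ∀ n : ℕ, ‖KernelSpace.mk K hK ((fun z ↦ g (f z))^[n] s)‖ ≤ C * (M ^ 2) ^ n) :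
    ∃ T : KernelSpace K hK →L[ℂ] KernelSpace K' hK',
      (∀ s, T (KernelSpace.mk K hK s) = KernelSpace.mk K' hK' (f s)) ∧ ‖T‖ ≤ M := by
  let F : KernelPre K hK →ₗ[ℂ] KernelPre K' hK' := Finsupp.lmapDomain ℂ ℂ f
  let G : KernelPre K' hK' →ₗ[ℂ] KernelPre K hK := Finsupp.lmapDomain ℂ ℂ g
  have hF : ∀ s, F (KernelPre.single K hK s) = KernelPre.single K' hK' (f s) := fun s ↦
    Finsupp.mapDomain_single
  have hG : ∀ s, G (KernelPre.single K' hK' s) = KernelPre.single K hK (g s) := fun s ↦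
    Finsupp.mapDomain_single
  have hadj : ∀ x y, ⟪F x, y⟫_ℂ = ⟪x, G y⟫_ℂ := by
    intro x y
    refine KernelPre.induction (P := fun x ↦ ⟪F x, y⟫_ℂ = ⟪x, G y⟫_ℂ) x (by simp) ?_ ?_ ?_
    · intro s
      refine KernelPre.induction (P := fun y ↦ ⟪F (KernelPre.single K hK s), y⟫_ℂ =
        ⟪KernelPre.single K hK s, G y⟫_ℂ) y (by simp) ?_ ?_ ?_
      · intro t; rw [hF, hG, KernelPre.inner_single, KernelPre.inner_single, hfg]
      · intro y y' h h'; rw [inner_add_right, h, h', map_add, inner_add_right]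
      · intro c y h; rw [inner_smul_right, h, map_smul, inner_smul_right]
    · intro x x' h h'; rw [inner_add_left, ← h, ← h', map_add, inner_add_left]
    · intro c x h; rw [inner_smul_left, ← h, map_smul, inner_smul_left]
  have hlin : ∀ n, ∃ Ln : KernelPre K hK →ₗ[ℂ] KernelPre K hK,
      ∀ z, (fun z ↦ G (F z))^[n] z = Ln z := by
    intro n
    refine ⟨(G ∘ₗ F) ^ n, fun z ↦ ?_⟩
    rw [Module.End.pow_apply]; rfl
  have hsingle : ∀ n s, (fun z ↦ G (F z))^[n] (KernelPre.single K hK s) =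
      KernelPre.single K hK ((fun z ↦ g (f z))^[n] s) := by
    intro n s
    induction n with
    | zero => rfl
    | succ n ih => rw [Function.iterate_succ_apply', ih, Function.iterate_succ_apply', hF, hG]
  have hgr : ∀ x, ∃ C : ℝ, ∀ n : ℕ, ‖(fun z ↦ G (F z))^[n] x‖ ≤ C * (M ^ 2) ^ n := by
    intro x
    refine KernelPre.induction (P := fun x ↦ ∃ C : ℝ, ∀ n : ℕ,
      ‖(fun z ↦ G (F z))^[n] x‖ ≤ C * (M ^ 2) ^ n) x ?_ ?_ ?_ ?_
    · refine ⟨0, fun n ↦ ?_⟩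
      obtain ⟨Ln, h⟩ := hlin n
      rw [h]; simp
    · intro s
      obtain ⟨C, hC⟩ := hb s
      refine ⟨C, fun n ↦ ?_⟩
      rw [hsingle]
      have := hC n
      rw [KernelSpace.mk] at this
      exact (Completion.norm_coe (KernelPre.single K hK _)).symm.le.trans this
    · rintro x y ⟨C, hC⟩ ⟨D, hD⟩
      refine ⟨C + D, fun n ↦ ?_⟩
      obtain ⟨Ln, h⟩ := hlin n
      have h1 := hC n
      have h2 := hD n
      rw [h] at h1 h2 ⊢
      rw [map_add, add_mul]
      exact (norm_add_le _ _).trans (add_le_add h1 h2)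
    · rintro c x ⟨C, hC⟩
      refine ⟨‖c‖ * C, fun n ↦ ?_⟩
      obtain ⟨Ln, h⟩ := hlin n
      have h1 := hC n
      rw [h] at h1 ⊢
      rw [map_smul, norm_smul, mul_assoc]
      gcongr
  have hFb : ∀ x, ‖F x‖ ≤ M * ‖x‖ := fun x ↦ by
    have := norm_sq_le_of_growth F G hadj (M ^ 2) (by positivity) x (hgr x)
    rw [← mul_pow] at this
    exact (sq_le_sq₀ (norm_nonneg _) (by positivity)).mp this
  let F' : KernelPre K hK →L[ℂ] KernelPre K' hK' := F.mkContinuous M hFb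
  have hF' : ∀ s, F' (KernelPre.single K hK s) = KernelPre.single K' hK' (f s) := hF
  refine ⟨F'.completion, fun s ↦ ?_, ?_⟩
  · exact (ContinuousLinearMap.completion_apply_coe F' _).trans (by rw [hF']; rfl)
  · refine ContinuousLinearMap.opNorm_le_bound _ hM fun x ↦ ?_
    refine Completion.induction_on x (isClosed_le (by fun_prop) (by fun_prop)) fun x ↦ ?_
    rw [ContinuousLinearMap.completion_apply_coe, Completion.norm_coe, Completion.norm_coe]
    exact hFb x

end Kernel

section KernelOps

variable {S : Type*}

lemma IsPSDKernel.gram {E : Type*} [SeminormedAddCommGroup E] [InnerProductSpace ℂ E] (φ : S → E) :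
    IsPSDKernel (fun s t ↦ ⟪φ s, φ t⟫_ℂ) where
  conj_symm s t := inner_conj_symm _ _
  re_nonneg f := by
    have h : (f.sum fun s c ↦ f.sum fun t d ↦ star c * ⟪φ s, φ t⟫_ℂ * d) =
        ⟪f.sum fun s c ↦ c • φ s, f.sum fun s c ↦ c • φ s⟫_ℂ := by
      simp only [Finsupp.sum]
      rw [sum_inner]
      refine Finset.sum_congr rfl fun s _ ↦ ?_
      rw [inner_sum]
      refine Finset.sum_congr rfl fun t _ ↦ ?_
      rw [inner_smul_left, inner_smul_right, Complex.star_def]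
      ring
    rw [h]
    exact inner_self_nonneg (𝕜 := ℂ)

lemma IsPSDKernel.mul {K K' : S → S → ℂ} (hK : IsPSDKernel K) (hK' : IsPSDKernel K') :
    IsPSDKernel (fun s t ↦ K s t * K' s t) := by
  have := IsPSDKernel.gram (S := S) (E := TensorProduct ℂ (KernelSpace K hK) (KernelSpace K' hK'))
    (fun s ↦ TensorProduct.tmul ℂ (KernelSpace.mk K hK s) (KernelSpace.mk K' hK' s))
  simpa only [TensorProduct.inner_tmul, KernelSpace.inner_mk] using this

lemma IsPSDKernel.prod {I : Type*} (F : Finset I) {K : I → S → S → ℂ}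
    (hK : ∀ v ∈ F, IsPSDKernel (K v)) : IsPSDKernel (fun s t ↦ ∏ v ∈ F, K v s t) := by
  classical
  induction F using Finset.induction_on with
  | empty => simpa using IsPSDKernel.gram (S := S) (fun _ ↦ (1 : ℂ))
  | insert v F hv ih =>
    simp only [Finset.prod_insert hv]
    exact (hK v (by simp)).mul (ih fun u hu ↦ hK u (by simp [hu]))

end KernelOps

/-! ### Restricted tensor products of Hilbert spaces -/

section Hilbert

variable {I : Type w}

/-- The families `(w_v)` with `w_v = x_v` for all but finitely many `v`: these label the simple
tensors `⊗ w_v` of a restricted tensor product with distinguished vectors `x_v`. -/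
def RestrictedFamily (W : I → Type u) (x : ∀ v, W v) : Type (max u w) :=
  {f : ∀ v, W v // ∀ᶠ v in cofinite, f v = x v}

instance {W : I → Type u} {x : ∀ v, W v} : CoeFun (RestrictedFamily W x) (fun _ ↦ ∀ v, W v) :=
  ⟨Subtype.val⟩

/-- Componentwise application of maps preserving almost all distinguished vectors. -/
def RestrictedFamily.map {W W' : I → Type u} {x : ∀ v, W v} {x' : ∀ v, W' v}
    (B : ∀ v, W v → W' v) (hB : ∀ᶠ v in cofinite, B v (x v) = x' v) (f : RestrictedFamily W x) :
    RestrictedFamily W' x' :=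
  ⟨fun v ↦ B v (f v), by filter_upwards [hB, f.2] with v h1 h2; rw [h2, h1]⟩

/-- Componentwise application of binary maps preserving almost all distinguished vectors. -/
def RestrictedFamily.map₂ {W W' W'' : I → Type u} {x : ∀ v, W v} {x' : ∀ v, W' v}
    {x'' : ∀ v, W'' v} (B : ∀ v, W v → W' v → W'' v)
    (hB : ∀ᶠ v in cofinite, B v (x v) (x' v) = x'' v)
    (f : RestrictedFamily W x) (g : RestrictedFamily W' x') : RestrictedFamily W'' x'' :=
  ⟨fun v ↦ B v (f v) (g v), by
    filter_upwards [hB, f.2, g.2] with v h1 h2 h3; rw [h2, h3, h1]⟩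

/-- A family of vectors `h_v` in Hilbert spaces `H_v` that are unit vectors at almost all places. -/
structure UnitFamily (H : I → Type u) [∀ v, NormedAddCommGroup (H v)] where
  vec : ∀ v, H v
  norm_eq : ∀ᶠ v in cofinite, ‖vec v‖ = 1

variable {H H' H'' : I → Type u}
  [∀ v, NormedAddCommGroup (H v)] [∀ v, InnerProductSpace ℂ (H v)]
  [∀ v, NormedAddCommGroup (H' v)] [∀ v, InnerProductSpace ℂ (H' v)]
  [∀ v, NormedAddCommGroup (H'' v)] [∀ v, InnerProductSpace ℂ (H'' v)]

/-- The inner product `⟪⊗ e_v, ⊗ f_v⟫ = ∏ ⟪e_v, f_v⟫` of simple tensors; almost all factors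
are `1`. -/
def tensorKernel (h : UnitFamily H) (e f : RestrictedFamily H h.vec) : ℂ :=
  ∏ᶠ v, ⟪e v, f v⟫_ℂ

lemma tensorKernel_eventually (h : UnitFamily H) (e f : RestrictedFamily H h.vec) :
    ∀ᶠ v in cofinite, ⟪e v, f v⟫_ℂ = 1 := by
  filter_upwards [h.norm_eq, e.2, f.2] with v h1 h2 h3
  rw [h2, h3, inner_self_eq_norm_sq_to_K, h1]; simp

lemma tensorKernel_psd (h : UnitFamily H) : IsPSDKernel (tensorKernel h) where
  conj_symm s t := by
    rw [tensorKernel, tensorKernel]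
    have h1 := tensorKernel_eventually h s t
    have h2 := tensorKernel_eventually h t s
    have hfin := (eventually_cofinite.mp (h1.and h2))
    rw [finprod_eq_prod_of_mulSupport_subset (s := hfin.toFinset),
      finprod_eq_prod_of_mulSupport_subset (s := hfin.toFinset)]
    · rw [star_prod]
      exact Finset.prod_congr rfl fun v _ ↦ inner_conj_symm _ _
    · intro v hv; simp only [Function.mem_mulSupport] at hv; simp [hv]
    · intro v hv
      simp only [Function.mem_mulSupport] at hv
      simp only [Set.Finite.coe_toFinset, Set.mem_ofPred_eq, not_and]
      exact fun _ ↦ hv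
  re_nonneg f := by
    have hall : ∀ᶠ v in cofinite, ∀ s ∈ f.support, ∀ t ∈ f.support, ⟪s v, t v⟫_ℂ = 1 := by
      rw [Finset.eventually_all]; intro s _
      rw [Finset.eventually_all]; intro t _
      exact tensorKernel_eventually h s t
    have hfin := eventually_cofinite.mp hall
    have hprod := IsPSDKernel.prod (S := RestrictedFamily H h.vec) hfin.toFinset
      (K := fun v s t ↦ ⟪s v, t v⟫_ℂ) (fun v _ ↦ IsPSDKernel.gram fun s : RestrictedFamily H h.vec ↦ s v)
    convert hprod.re_nonneg f using 2
    refine Finset.sum_congr rfl fun s hs ↦ Finset.sum_congr rfl fun t ht ↦ ?_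
    have : tensorKernel h s t = ∏ v ∈ hfin.toFinset, ⟪s v, t v⟫_ℂ := by
      refine finprod_eq_prod_of_mulSupport_subset _ fun v hv ↦ ?_
      simp only [Function.mem_mulSupport] at hv
      simp only [Set.Finite.coe_toFinset, Set.mem_ofPred_eq]
      exact fun hh ↦ hv (hh s hs t ht)
    simp only [this]

/-- The restricted tensor product `⊗' (H_v, h_v)` of Hilbert spaces: the completion of the linear
span of the simple tensors `⊗ e_v`, `e_v = h_v` for almost all `v`, with respect to the inner
product `⟪⊗ e_v, ⊗ f_v⟫ = ∏ ⟪e_v, f_v⟫`. (The linear relations between simple tensors are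
exactly the null vectors of this semi-inner product on the free vector space.) -/
abbrev HilbertTensor (h : UnitFamily H) : Type (max u w) :=
  KernelSpace (tensorKernel h) (tensorKernel_psd h)

/-- The simple tensor `⊗ e_v`. -/
def HilbertTensor.tprod (h : UnitFamily H) (e : RestrictedFamily H h.vec) : HilbertTensor h :=
  KernelSpace.mk _ _ e

lemma HilbertTensor.inner_tprod (h : UnitFamily H) (e f : RestrictedFamily H h.vec) :
    ⟪HilbertTensor.tprod h e, HilbertTensor.tprod h f⟫_ℂ = ∏ᶠ v, ⟪e v, f v⟫_ℂ :=
  KernelSpace.inner_mk e f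

variable [∀ v, CompleteSpace (H v)] [∀ v, CompleteSpace (H' v)] [∀ v, CompleteSpace (H'' v)]
  {h : UnitFamily H} {h' : UnitFamily H'} {h'' : UnitFamily H''}

lemma adjoint_eventually (B : ∀ v, H v →L[ℂ] H' v)
    (hB : ∀ᶠ v in cofinite, B v (h.vec v) = h'.vec v ∧ ‖B v‖ ≤ 1) :
    ∀ᶠ v in cofinite, (B v).adjoint (h'.vec v) = h.vec v ∧ ‖(B v).adjoint‖ ≤ 1 := by
  filter_upwards [hB, h.norm_eq, h'.norm_eq] with v h1 h2 h3
  have h4 : ‖(B v).adjoint‖ ≤ 1 := by rw [LinearIsometryEquiv.norm_map]; exact h1.2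
  refine ⟨?_, h4⟩
  have h5 : ‖(B v).adjoint (h'.vec v)‖ ≤ 1 := by
    have := (B v).adjoint.le_of_opNorm_le h4 (h'.vec v)
    rwa [h3, one_mul] at this
  have h6 : ⟪(B v).adjoint (h'.vec v), h.vec v⟫_ℂ = 1 := by
    rw [ContinuousLinearMap.adjoint_inner_left, h1.1, inner_self_eq_norm_sq_to_K, h3]; simp
  have h7 : ‖(B v).adjoint (h'.vec v) - h.vec v‖ ^ 2 ≤ 0 := by
    rw [norm_sub_sq (𝕜 := ℂ), h6, h2]
    simp only [RCLike.one_re]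
    nlinarith [norm_nonneg ((B v).adjoint (h'.vec v))]
  have h8 : ‖(B v).adjoint (h'.vec v) - h.vec v‖ = 0 := by
    have := le_antisymm h7 (sq_nonneg _)
    exact pow_eq_zero_iff (two_ne_zero) |>.mp this
  exact sub_eq_zero.mp (norm_eq_zero.mp h8)

lemma HilbertTensor.exists_map (B : ∀ v, H v →L[ℂ] H' v)
    (hB : ∀ᶠ v in cofinite, B v (h.vec v) = h'.vec v ∧ ‖B v‖ ≤ 1) :
    ∃ T : HilbertTensor h →L[ℂ] HilbertTensor h',
      (∀ e, T (tprod h e) = tprod h' (e.map (fun v ↦ B v) (hB.mono fun _ h ↦ h.1))) ∧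
        ‖T‖ ≤ ∏ᶠ v, max 1 ‖B v‖ := by
  have hB' := adjoint_eventually B hB
  refine KernelSpace.exists_map _
    (fun e ↦ e.map (fun v ↦ (B v).adjoint) (hB'.mono fun _ h ↦ h.1)) ?_ _ ?_ ?_
  · intro s t
    refine finprod_congr fun v ↦ ?_
    simp only [RestrictedFamily.map]
    rw [ContinuousLinearMap.adjoint_inner_right]
  · exact finprod_nonneg fun v ↦ by positivity
  · intro e
    have hall := ((hB.and hB').and (h.norm_eq.and e.2))
    have hfin := eventually_cofinite.mp hall
    set F := hfin.toFinset with hF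
    have hnotF : ∀ v, v ∉ F → ((B v (h.vec v) = h'.vec v ∧ ‖B v‖ ≤ 1) ∧
        (B v).adjoint (h'.vec v) = h.vec v ∧ ‖(B v).adjoint‖ ≤ 1) ∧
        ‖h.vec v‖ = 1 ∧ e v = h.vec v := by
      intro v hv
      rw [hF, Set.Finite.mem_toFinset, Set.mem_ofPred_eq, not_not] at hv
      exact hv
    have hM : ∏ᶠ v, max 1 ‖B v‖ = ∏ v ∈ F, max 1 ‖B v‖ := by
      refine finprod_eq_prod_of_mulSupport_subset _ fun v hv ↦ ?_
      by_contra hvF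
      exact hv (max_eq_left (hnotF v hvF).1.1.2)
    set g : RestrictedFamily H h.vec → RestrictedFamily H h.vec := fun z ↦
      (z.map (fun v ↦ B v) (hB.mono fun _ h ↦ h.1)).map (x' := h.vec) (fun v ↦ (B v).adjoint)
        (hB'.mono fun _ h ↦ h.1) with hg
    have hit : ∀ n v, (g^[n] e) v = (fun y ↦ (B v).adjoint (B v y))^[n] (e v) := by
      intro n v
      induction n with
      | zero => rfl
      | succ n ih => rw [Function.iterate_succ_apply', Function.iterate_succ_apply', ← ih]; rfl
    have hbound : ∀ n v, ‖(g^[n] e) v‖ ≤ ((max 1 ‖B v‖) ^ 2) ^ n * ‖e v‖ := by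
      intro n v
      rw [hit]
      induction n with
      | zero => simp
      | succ n ih =>
        rw [Function.iterate_succ_apply']
        calc _ ≤ ‖(B v).adjoint‖ * (‖B v‖ * ‖(fun y ↦ (B v).adjoint (B v y))^[n] (e v)‖) :=
              ((B v).adjoint.le_opNorm _).trans (by gcongr; exact (B v).le_opNorm _)
          _ ≤ max 1 ‖B v‖ * (max 1 ‖B v‖ * (((max 1 ‖B v‖) ^ 2) ^ n * ‖e v‖)) := by
              rw [LinearIsometryEquiv.norm_map]
              gcongr <;> exact le_max_right _ _
          _ = _ := by ring
    have hone : ∀ n v, v ∉ F → ‖(g^[n] e) v‖ = 1 := by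
      intro n v hv
      obtain ⟨⟨⟨a1, -⟩, a2, -⟩, a3, a4⟩ := hnotF v hv
      have : (g^[n] e) v = h.vec v := by
        rw [hit]
        induction n with
        | zero => exact a4
        | succ n ih => rw [Function.iterate_succ_apply', ih, a1, a2]
      rw [this, a3]
    refine ⟨∏ v ∈ F, ‖e v‖, fun n ↦ ?_⟩
    have hnorm : ‖KernelSpace.mk (tensorKernel h) (tensorKernel_psd h) (g^[n] e)‖ =
        ∏ v ∈ F, ‖(g^[n] e) v‖ := by
      rw [← sq_eq_sq₀ (norm_nonneg _) (Finset.prod_nonneg fun _ _ ↦ norm_nonneg _),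
        KernelSpace.norm_mk_sq, tensorKernel, ← Finset.prod_pow,
        finprod_eq_prod_of_mulSupport_subset (s := F)]
      · have : ∀ v, ⟪(g^[n] e) v, (g^[n] e) v⟫_ℂ = ((‖(g^[n] e) v‖ ^ 2 : ℝ) : ℂ) := fun v ↦ by
          rw [inner_self_eq_norm_sq_to_K]; simp
        simp only [this]
        rw [← Complex.ofReal_prod, Complex.ofReal_re]
      · intro v hv
        by_contra hvF
        refine hv ?_
        simp only
        rw [inner_self_eq_norm_sq_to_K, hone n v hvF]; simp
    rw [hnorm, hM, ← Finset.prod_pow, ← Finset.prod_pow, ← Finset.prod_mul_distrib]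
    refine Finset.prod_le_prod (fun _ _ ↦ norm_nonneg _) fun v _ ↦ ?_
    rw [mul_comm]
    exact hbound n v

/-- The bounded operator `⊗' B_v`, `⊗ e_v ↦ ⊗ B_v e_v`, for bounded operators `B_v` which are
contractions respecting the distinguished vectors at almost all places. -/
def HilbertTensor.map (B : ∀ v, H v →L[ℂ] H' v)
    (hB : ∀ᶠ v in cofinite, B v (h.vec v) = h'.vec v ∧ ‖B v‖ ≤ 1) :
    HilbertTensor h →L[ℂ] HilbertTensor h' :=
  (HilbertTensor.exists_map B hB).choose

lemma HilbertTensor.map_tprod (B : ∀ v, H v →L[ℂ] H' v)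
    (hB : ∀ᶠ v in cofinite, B v (h.vec v) = h'.vec v ∧ ‖B v‖ ≤ 1)
    (e : RestrictedFamily H h.vec) :
    HilbertTensor.map B hB (tprod h e) =
      tprod h' (e.map (fun v ↦ B v) (hB.mono fun _ h ↦ h.1)) :=
  (HilbertTensor.exists_map B hB).choose_spec.1 e

lemma HilbertTensor.norm_map_le (B : ∀ v, H v →L[ℂ] H' v)
    (hB : ∀ᶠ v in cofinite, B v (h.vec v) = h'.vec v ∧ ‖B v‖ ≤ 1) :
    ‖HilbertTensor.map B hB‖ ≤ ∏ᶠ v, max 1 ‖B v‖ :=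
  (HilbertTensor.exists_map B hB).choose_spec.2

lemma HilbertTensor.map_comp (B : ∀ v, H v →L[ℂ] H' v)
    (hB : ∀ᶠ v in cofinite, B v (h.vec v) = h'.vec v ∧ ‖B v‖ ≤ 1) (C : ∀ v, H' v →L[ℂ] H'' v)
    (hC : ∀ᶠ v in cofinite, C v (h'.vec v) = h''.vec v ∧ ‖C v‖ ≤ 1)
    (hCB : ∀ᶠ v in cofinite, (C v ∘L B v) (h.vec v) = h''.vec v ∧ ‖C v ∘L B v‖ ≤ 1) :
    HilbertTensor.map (fun v ↦ C v ∘L B v) hCB = HilbertTensor.map C hC ∘L HilbertTensor.map B hB := by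
  refine KernelSpace.clm_ext fun e ↦ ?_
  change HilbertTensor.map _ hCB (tprod h e) =
    HilbertTensor.map C hC (HilbertTensor.map B hB (tprod h e))
  rw [HilbertTensor.map_tprod, HilbertTensor.map_tprod, HilbertTensor.map_tprod]
  rfl

lemma HilbertTensor.adjoint_map (B : ∀ v, H v →L[ℂ] H' v)
    (hB : ∀ᶠ v in cofinite, B v (h.vec v) = h'.vec v ∧ ‖B v‖ ≤ 1)
    (hB' : ∀ᶠ v in cofinite, (B v).adjoint (h'.vec v) = h.vec v ∧ ‖(B v).adjoint‖ ≤ 1) :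
    (HilbertTensor.map B hB).adjoint = HilbertTensor.map (fun v ↦ (B v).adjoint) hB' := by
  refine KernelSpace.clm_ext fun e ↦ ?_
  refine ext_inner_right ℂ fun y ↦ ?_
  refine KernelSpace.induction (P := fun y ↦ ⟪(HilbertTensor.map B hB).adjoint (tprod h' e), y⟫_ℂ =
    ⟪HilbertTensor.map (fun v ↦ (B v).adjoint) hB' (tprod h' e), y⟫_ℂ) y
    (isClosed_eq (by fun_prop) (by fun_prop)) (by simp) ?_ ?_ ?_
  · intro f
    change ⟪(HilbertTensor.map B hB).adjoint (tprod h' e), tprod h f⟫_ℂ = ⟪_, tprod h f⟫_ℂ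
    rw [ContinuousLinearMap.adjoint_inner_left, HilbertTensor.map_tprod, HilbertTensor.map_tprod,
      HilbertTensor.inner_tprod, HilbertTensor.inner_tprod]
    refine finprod_congr fun v ↦ ?_
    simp only [RestrictedFamily.map]
    rw [ContinuousLinearMap.adjoint_inner_left]
  · intro f g hf hg; rw [inner_add_right, hf, hg, inner_add_right]
  · intro c f hf; rw [inner_smul_right, hf, inner_smul_right]

end Hilbert

/-! ### Right Hilbert modules over `C*`-algebras -/

/-- A right (pre-)Hilbert `C*`-module `X` over a `C*`-algebra `A`: a right `A`-module with an
`A`-valued inner product which is linear in the second variable, hermitian and positive, with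
`⟨x, y a⟩ = ⟨x, y⟩ a`, and such that the given norm is `‖⟨x, x⟩‖ ^ (1/2)`.
(Definiteness holds since the norm is a norm, and that `x ↦ x a` is a bilinear associative action
follows from the other axioms, see below. It is a Hilbert module if in addition `X` is complete.
Mathlib's `CStarModule A X` is about *left* actions.) -/
class RightHilbertModule (A : Type*) (X : Type*) [NonUnitalCStarAlgebra A]
    [NormedAddCommGroup X] [NormedSpace ℂ X] where
  /-- the `A`-valued inner product -/
  hinner : X → X → A
  /-- the right action of `A` -/
  rsmul : X → A → X
  hinner_add_right : ∀ x y z, hinner x (y + z) = hinner x y + hinner x z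
  hinner_smul_right : ∀ (c : ℂ) x y, hinner x (c • y) = c • hinner x y
  hinner_rsmul_right : ∀ x y a, hinner x (rsmul y a) = hinner x y * a
  star_hinner : ∀ x y, star (hinner x y) = hinner y x
  hinner_self_nonneg : ∀ x, ∃ b, hinner x x = star b * b
  norm_sq_eq : ∀ x, ‖x‖ ^ 2 = ‖hinner x x‖

section Module

variable (A : Type*) {X : Type*} [NonUnitalCStarAlgebra A] [NormedAddCommGroup X]
  [NormedSpace ℂ X] [RightHilbertModule A X]

/-- The `A`-valued inner product `⟨x, y⟩` of a right Hilbert `A`-module. -/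
def hinner (x y : X) : A := RightHilbertModule.hinner x y

variable {A}

/-- The right action `x a`. -/
def rsmul (x : X) (a : A) : X := RightHilbertModule.rsmul x a

lemma star_hinner (x y : X) : star (hinner A x y) = hinner A y x :=
  RightHilbertModule.star_hinner x y

lemma hinner_add_right (x y z : X) : hinner A x (y + z) = hinner A x y + hinner A x z :=
  RightHilbertModule.hinner_add_right x y z

lemma hinner_smul_right (c : ℂ) (x y : X) : hinner A x (c • y) = c • hinner A x y :=
  RightHilbertModule.hinner_smul_right c x y

lemma hinner_rsmul_right (x y : X) (a : A) : hinner A x (rsmul y a) = hinner A x y * a :=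
  RightHilbertModule.hinner_rsmul_right x y a

lemma hinner_add_left (x y z : X) : hinner A (x + y) z = hinner A x z + hinner A y z := by
  rw [← star_hinner, hinner_add_right, star_add, star_hinner, star_hinner]

lemma hinner_smul_left (c : ℂ) (x y : X) : hinner A (c • x) y = star c • hinner A x y := by
  rw [← star_hinner, hinner_smul_right, star_smul, star_hinner]

lemma hinner_rsmul_left (x y : X) (a : A) : hinner A (rsmul x a) y = star a * hinner A x y := by
  rw [← star_hinner, hinner_rsmul_right, star_mul, star_hinner]

lemma hinner_sub_right (x y z : X) : hinner A x (y - z) = hinner A x y - hinner A x z := by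
  rw [sub_eq_add_neg, ← neg_one_smul ℂ z, hinner_add_right, hinner_smul_right]
  simp [sub_eq_add_neg]

lemma hinner_zero_right (x : X) : hinner A x 0 = 0 := by
  simpa using hinner_smul_right (A := A) 0 x 0

lemma hinner_zero_left (x : X) : hinner A 0 x = 0 := by
  rw [← star_hinner, hinner_zero_right, star_zero]

lemma hinner_sum_right {ι : Type*} (F : Finset ι) (x : X) (y : ι → X) :
    hinner A x (∑ i ∈ F, y i) = ∑ i ∈ F, hinner A x (y i) := by
  classical
  induction F using Finset.induction_on with
  | empty => simp [hinner_zero_right]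
  | insert i F hi ih => rw [Finset.sum_insert hi, Finset.sum_insert hi, hinner_add_right, ih]

lemma hinner_sum_left {ι : Type*} (F : Finset ι) (x : X) (y : ι → X) :
    hinner A (∑ i ∈ F, y i) x = ∑ i ∈ F, hinner A (y i) x := by
  rw [← star_hinner, hinner_sum_right, star_sum]
  simp only [star_hinner]

variable (A) in
lemma norm_sq_eq_norm_hinner (x : X) : ‖x‖ ^ 2 = ‖hinner A x x‖ :=
  RightHilbertModule.norm_sq_eq x

variable (A) in
lemma ext_hinner {y z : X} (h : ∀ x : X, hinner A x y = hinner A x z) : y = z := by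
  have : ‖y - z‖ ^ 2 = 0 := by
    rw [norm_sq_eq_norm_hinner A, hinner_sub_right, h, sub_self, norm_zero]
  exact sub_eq_zero.mp (norm_eq_zero.mp (pow_eq_zero_iff two_ne_zero |>.mp this))

lemma rsmul_mul (x : X) (a b : A) : rsmul x (a * b) = rsmul (rsmul x a) b :=
  ext_hinner A fun y ↦ by simp only [hinner_rsmul_right, mul_assoc]

lemma rsmul_add (x : X) (a b : A) : rsmul x (a + b) = rsmul x a + rsmul x b :=
  ext_hinner A fun y ↦ by simp only [hinner_rsmul_right, hinner_add_right, mul_add]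

lemma add_rsmul (x y : X) (a : A) : rsmul (x + y) a = rsmul x a + rsmul y a :=
  ext_hinner A fun z ↦ by simp only [hinner_rsmul_right, hinner_add_right, add_mul]

lemma rsmul_smul (c : ℂ) (x : X) (a : A) : rsmul x (c • a) = c • rsmul x a :=
  ext_hinner A fun z ↦ by simp only [hinner_rsmul_right, hinner_smul_right, mul_smul_comm]

lemma smul_rsmul (c : ℂ) (x : X) (a : A) : rsmul (c • x) a = c • rsmul x a :=
  ext_hinner A fun z ↦ by simp only [hinner_rsmul_right, hinner_smul_right, smul_mul_assoc]

/-- The negative part of a self-adjoint element `G` compresses `G` to minus its own cube. -/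
lemma exists_negPart {M : Type*} [NonUnitalCStarAlgebra M] [PartialOrder M] [StarOrderedRing M]
    (G : M) (hG : IsSelfAdjoint G) :
    ∃ N : M, 0 ≤ N ∧ N * G * N = -(N * N * N) ∧ (N = 0 → 0 ≤ G) := by
  have hdec : G⁺ - G⁻ = G := CFC.posPart_sub_negPart G hG
  have hort' : G⁻ * G⁺ = 0 := CFC.negPart_mul_posPart G
  refine ⟨G⁻, CFC.negPart_nonneg G, ?_, fun hN ↦ ?_⟩
  · have h : G⁻ * G = -(G⁻ * G⁻) := by
      calc G⁻ * G = G⁻ * (G⁺ - G⁻) := by rw [hdec]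
        _ = _ := by rw [mul_sub, hort', zero_sub]
    rw [h, neg_mul]
  · rw [← hdec, hN, sub_zero]; exact CFC.posPart_nonneg G

lemma exists_star_mul_self {M : Type*} [NonUnitalCStarAlgebra M] [PartialOrder M]
    [StarOrderedRing M] {a : M} (ha : 0 ≤ a) : ∃ b, a = star b * b :=
  CStarAlgebra.nonneg_iff_eq_star_mul_self.mp ha

/-- The Gram matrix of a finite family in a Hilbert `A`-module is positive in the `C*`-algebra of
matrices over `A`. -/
lemma exists_gram_eq {n : Type*} [Fintype n] (x : n → X) :
    ∃ B : n → n → A, ∀ i j, hinner A (x i) (x j) = ∑ k, star (B k i) * B k j := by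
  classical
  let _ : PartialOrder A := CStarAlgebra.spectralOrder A
  have _ : StarOrderedRing A := CStarAlgebra.spectralOrderedRing A
  let _ : PartialOrder (CStarMatrix n n A) := CStarAlgebra.spectralOrder _
  have _ : StarOrderedRing (CStarMatrix n n A) := CStarAlgebra.spectralOrderedRing _
  let G : CStarMatrix n n A := CStarMatrix.ofMatrix (fun i j ↦ hinner A (x i) (x j))
  have hG : ∀ i j, G i j = hinner A (x i) (x j) := fun _ _ ↦ rfl
  have hGsa : IsSelfAdjoint G := by
    rw [isSelfAdjoint_iff]
    ext i j
    rw [CStarMatrix.star_apply, hG, hG, star_hinner]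
  obtain ⟨N, hN0, hNGN, hNG⟩ := exists_negPart G hGsa
  have hNsa : star N = N := (IsSelfAdjoint.of_nonneg hN0).star_eq
  obtain ⟨b, hb⟩ := exists_star_mul_self hN0
  set M : CStarMatrix n n A := b * N with hM
  have hMM : star M * M = N * N * N := by
    rw [hM, star_mul, hNsa]
    calc N * star b * (b * N) = N * (star b * b) * N := by simp only [mul_assoc]
      _ = _ := by rw [← hb]
  have hM0 : M = 0 := by
    have hdiag : ∀ l, ∑ k, star (M k l) * M k l ≤ 0 := by
      intro l
      let z : X := ∑ j, rsmul (x j) (N j l)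
      have h1 : (N * G * N) l l = hinner A z z := by
        simp only [CStarMatrix.mul_apply, z, hinner_sum_left, hinner_sum_right, hinner_rsmul_left,
          hinner_rsmul_right, hG, Finset.sum_mul]
        refine Finset.sum_congr rfl fun j _ ↦ Finset.sum_congr rfl fun i _ ↦ ?_
        have : star (N i l) = N l i := by
          rw [← CStarMatrix.star_apply, hNsa]
        rw [this, mul_assoc]
      have h2 : ∑ k, star (M k l) * M k l = - hinner A z z := by
        rw [← h1, hNGN, ← hMM, CStarMatrix.neg_apply, neg_neg, CStarMatrix.mul_apply]
        rfl
      obtain ⟨c, hc⟩ := RightHilbertModule.hinner_self_nonneg (A := A) z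
      rw [h2, hinner, hc]
      exact neg_nonpos.mpr (star_mul_self_nonneg c)
    ext k l
    have h3 := (Finset.sum_eq_zero_iff_of_nonneg (fun k _ ↦ star_mul_self_nonneg (M k l))).mp
      (le_antisymm (hdiag l) (Finset.sum_nonneg fun k _ ↦ star_mul_self_nonneg (M k l))) k
      (Finset.mem_univ k)
    exact CStarRing.star_mul_self_eq_zero_iff _ |>.mp h3
  have hNNN : N * N * N = 0 := by rw [← hMM, hM0]; simp
  have hNN : N * N = 0 := by
    rw [← CStarRing.star_mul_self_eq_zero_iff, star_mul, hNsa]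
    calc _ = N * N * N * N := by simp only [mul_assoc]
      _ = 0 := by rw [hNNN, zero_mul]
  have hN : N = 0 := by
    rw [← CStarRing.star_mul_self_eq_zero_iff, hNsa, hNN]
  have hGpos : 0 ≤ G := hNG hN
  obtain ⟨B, hB⟩ := exists_star_mul_self hGpos
  refine ⟨B, fun i j ↦ ?_⟩
  rw [← hG, hB, CStarMatrix.mul_apply]
  rfl

variable (A X) in
/-- The bounded operators on `X` having an adjoint for the `A`-valued inner product (they are
automatically `A`-linear). -/
def adjointableSubalgebra : Subalgebra ℂ (X →L[ℂ] X) where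
  carrier := {T | ∃ R : X →L[ℂ] X, ∀ x y, hinner A (T x) y = hinner A x (R y)}
  mul_mem' := by
    rintro T T' ⟨R, hR⟩ ⟨R', hR'⟩
    exact ⟨R' * R, fun x y ↦ by
      rw [mul_apply_eq_comp, hR, hR', mul_apply_eq_comp]⟩
  add_mem' := by
    rintro T T' ⟨R, hR⟩ ⟨R', hR'⟩
    exact ⟨R + R', fun x y ↦ by
      rw [add_apply, hinner_add_left, hR, hR', add_apply,
        hinner_add_right]⟩
  algebraMap_mem' c := ⟨algebraMap ℂ _ (star c), fun x y ↦ by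
    rw [Algebra.algebraMap_eq_smul_one, Algebra.algebraMap_eq_smul_one]
    simp [hinner_smul_left, hinner_smul_right]⟩

variable (A X) in
/-- The algebra `End*_A(X)` of adjointable operators on the Hilbert `A`-module `X`. -/
def Adjointable : Type _ := adjointableSubalgebra A X

instance : NormedRing (Adjointable A X) := inferInstanceAs (NormedRing (adjointableSubalgebra A X))
instance : NormedAlgebra ℂ (Adjointable A X) :=
  inferInstanceAs (NormedAlgebra ℂ (adjointableSubalgebra A X))

/-- The underlying bounded operator. -/
def Adjointable.toCLM : Adjointable A X →ₐ[ℂ] (X →L[ℂ] X) := (adjointableSubalgebra A X).val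

instance : CoeFun (Adjointable A X) (fun _ ↦ X → X) := ⟨fun T ↦ T.toCLM⟩

lemma Adjointable.ext {T R : Adjointable A X} (h : ∀ x, T x = R x) : T = R :=
  Subtype.ext (ContinuousLinearMap.ext h)

lemma Adjointable.exists_adjoint (T : Adjointable A X) :
    ∃ R : Adjointable A X, ∀ x y, hinner A (T x) y = hinner A x (R y) := by
  obtain ⟨R, hR⟩ := T.2
  refine ⟨⟨R, T.1, fun x y ↦ ?_⟩, hR⟩
  rw [← star_hinner, ← hR, star_hinner]

/-- The `*`-operation of `End*_A(X)`: the adjoint for the `A`-valued inner product. -/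
instance : Star (Adjointable A X) := ⟨fun T ↦ T.exists_adjoint.choose⟩

lemma Adjointable.hinner_apply_left (T : Adjointable A X) (x y : X) :
    hinner A (T x) y = hinner A x ((star T) y) :=
  T.exists_adjoint.choose_spec x y

lemma Adjointable.hinner_apply_right (T : Adjointable A X) (x y : X) :
    hinner A x (T y) = hinner A ((star T) x) y := by
  rw [← star_hinner, Adjointable.hinner_apply_left, star_hinner]

lemma Adjointable.add_apply (T R : Adjointable A X) (x : X) : (T + R) x = T x + R x := rfl
lemma Adjointable.mul_apply (T R : Adjointable A X) (x : X) : (T * R) x = T (R x) := rfl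
lemma Adjointable.smul_apply (c : ℂ) (T : Adjointable A X) (x : X) : (c • T) x = c • T x := rfl

instance : StarRing (Adjointable A X) where
  star_involutive T := Adjointable.ext fun x ↦ ext_hinner A fun y ↦ by
    rw [← Adjointable.hinner_apply_left, ← Adjointable.hinner_apply_right]
  star_mul T R := Adjointable.ext fun x ↦ ext_hinner A fun y ↦ by
    rw [← Adjointable.hinner_apply_left]
    simp only [Adjointable.mul_apply]
    rw [Adjointable.hinner_apply_left, Adjointable.hinner_apply_left]
  star_add T R := Adjointable.ext fun x ↦ ext_hinner A fun y ↦ by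
    rw [← Adjointable.hinner_apply_left]
    simp only [Adjointable.add_apply, hinner_add_left, hinner_add_right,
      Adjointable.hinner_apply_left]

instance : StarModule ℂ (Adjointable A X) where
  star_smul c T := Adjointable.ext fun x ↦ ext_hinner A fun y ↦ by
    rw [← Adjointable.hinner_apply_left]
    simp only [Adjointable.smul_apply, hinner_smul_left, hinner_smul_right,
      Adjointable.hinner_apply_left]

end Module

/-! ### Interior tensor products with representations -/

section Interior

variable {A : Type*} {X : Type*} {H : Type*} [NonUnitalCStarAlgebra A] [NormedAddCommGroup X]
  [NormedSpace ℂ X] [RightHilbertModule A X] [NormedAddCommGroup H] [InnerProductSpace ℂ H]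
  [CompleteSpace H]

/-- The inner product `⟪x ⊗ ξ, y ⊗ η⟫ = ⟪ξ, π(⟨x, y⟩) η⟫`. -/
def interiorKernel (X : Type*) [NormedAddCommGroup X] [NormedSpace ℂ X] [RightHilbertModule A X]
    (π : A →⋆ₙₐ[ℂ] (H →L[ℂ] H)) (s t : X × H) : ℂ :=
  ⟪s.2, π (hinner A s.1 t.1) t.2⟫_ℂ

lemma interiorKernel_psd (π : A →⋆ₙₐ[ℂ] (H →L[ℂ] H)) : IsPSDKernel (interiorKernel X π) where
  conj_symm s t := by
    rw [interiorKernel, interiorKernel, Complex.star_def, inner_conj_symm, ← star_hinner, map_star,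
      ContinuousLinearMap.star_eq_adjoint, ContinuousLinearMap.adjoint_inner_left]
  re_nonneg f := by
    obtain ⟨B, hB⟩ := exists_gram_eq (A := A) (fun s : f.support ↦ s.1.1)
    have h : (f.sum fun s c ↦ f.sum fun t d ↦ star c * interiorKernel X π s t * d) =
        ∑ k, ⟪∑ s : f.support, f s • π (B k s) s.1.2, ∑ s : f.support, f s • π (B k s) s.1.2⟫_ℂ := by
      simp only [Finsupp.sum]
      rw [← Finset.sum_attach]
      have : ∀ s ∈ f.support.attach, (∑ t ∈ f.support, star (f s) * interiorKernel X π s t * f t) =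
          ∑ k, ∑ t : f.support, ⟪f s • π (B k s) s.1.2, f t • π (B k t) t.1.2⟫_ℂ := by
        intro s _
        rw [← Finset.sum_attach, Finset.sum_comm]
        refine Finset.sum_congr rfl fun t _ ↦ ?_
        rw [interiorKernel, hB s t, map_sum, sum_apply, inner_sum,
          Finset.mul_sum, Finset.sum_mul]
        refine Finset.sum_congr rfl fun k _ ↦ ?_
        rw [map_mul, map_star, ContinuousLinearMap.star_eq_adjoint, mul_apply_eq_comp,
          ContinuousLinearMap.adjoint_inner_right, inner_smul_left, inner_smul_right,
          Complex.star_def]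
        ring
      rw [Finset.sum_congr rfl this, Finset.sum_comm]
      refine Finset.sum_congr rfl fun k _ ↦ ?_
      rw [sum_inner]
      refine Finset.sum_congr rfl fun s _ ↦ ?_
      rw [inner_sum]
    rw [h, Complex.re_sum]
    exact Finset.sum_nonneg fun k _ ↦ inner_self_nonneg (𝕜 := ℂ)

/-- The interior tensor product `X ⊗_A H` of a right Hilbert `A`-module `X` with the representation
`π` of `A` on `H`: the completion of the span of the elementary tensors `x ⊗ ξ` with respect to
`⟪x ⊗ ξ, y ⊗ η⟫ = ⟪ξ, π(⟨x, y⟩) η⟫`. -/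
abbrev InteriorTensor (X : Type*) [NormedAddCommGroup X] [NormedSpace ℂ X]
    [RightHilbertModule A X] (π : A →⋆ₙₐ[ℂ] (H →L[ℂ] H)) : Type _ :=
  KernelSpace (interiorKernel X π) (interiorKernel_psd π)

/-- The elementary tensor `x ⊗ ξ` in `X ⊗_A H`. -/
def InteriorTensor.tmul (π : A →⋆ₙₐ[ℂ] (H →L[ℂ] H)) (x : X) (ξ : H) : InteriorTensor X π :=
  KernelSpace.mk _ _ (x, ξ)

variable {π : A →⋆ₙₐ[ℂ] (H →L[ℂ] H)}

lemma InteriorTensor.inner_tmul (x y : X) (ξ η : H) :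
    ⟪InteriorTensor.tmul π x ξ, InteriorTensor.tmul π y η⟫_ℂ = ⟪ξ, π (hinner A x y) η⟫_ℂ :=
  KernelSpace.inner_mk _ _

lemma KernelSpace.ext_inner {S : Type*} {K : S → S → ℂ} {hK : IsPSDKernel K}
    {x y : KernelSpace K hK}
    (h : ∀ s, ⟪KernelSpace.mk K hK s, x⟫_ℂ = ⟪KernelSpace.mk K hK s, y⟫_ℂ) : x = y := by
  refine ext_inner_left ℂ fun z ↦ ?_
  refine KernelSpace.induction (P := fun z ↦ ⟪z, x⟫_ℂ = ⟪z, y⟫_ℂ) z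
    (isClosed_eq (by fun_prop) (by fun_prop)) (by simp) h ?_ ?_
  · intro f g hf hg; rw [inner_add_left, hf, hg, inner_add_left]
  · intro c f hf; rw [inner_smul_left, hf, inner_smul_left]

lemma InteriorTensor.ext_inner {z z' : InteriorTensor X π}
    (h : ∀ x ξ, ⟪InteriorTensor.tmul π x ξ, z⟫_ℂ = ⟪InteriorTensor.tmul π x ξ, z'⟫_ℂ) : z = z' :=
  KernelSpace.ext_inner fun s ↦ h s.1 s.2

lemma InteriorTensor.clm_ext {E : Type*} [NormedAddCommGroup E] [NormedSpace ℂ E]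
    {T T' : InteriorTensor X π →L[ℂ] E}
    (h : ∀ x ξ, T (InteriorTensor.tmul π x ξ) = T' (InteriorTensor.tmul π x ξ)) : T = T' :=
  KernelSpace.clm_ext fun s ↦ h s.1 s.2

lemma InteriorTensor.add_tmul (x y : X) (ξ : H) :
    InteriorTensor.tmul π (x + y) ξ = InteriorTensor.tmul π x ξ + InteriorTensor.tmul π y ξ :=
  InteriorTensor.ext_inner fun z η ↦ by
    simp only [inner_add_right, InteriorTensor.inner_tmul, hinner_add_right, map_add,
      add_apply]

lemma InteriorTensor.smul_tmul (c : ℂ) (x : X) (ξ : H) :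
    InteriorTensor.tmul π (c • x) ξ = c • InteriorTensor.tmul π x ξ :=
  InteriorTensor.ext_inner fun z η ↦ by
    simp only [inner_smul_right, InteriorTensor.inner_tmul, hinner_smul_right, map_smul,
      smul_apply]

lemma InteriorTensor.tmul_add (x : X) (ξ η : H) :
    InteriorTensor.tmul π x (ξ + η) = InteriorTensor.tmul π x ξ + InteriorTensor.tmul π x η :=
  InteriorTensor.ext_inner fun z η ↦ by
    simp only [inner_add_right, InteriorTensor.inner_tmul, map_add]

lemma InteriorTensor.tmul_smul (c : ℂ) (x : X) (ξ : H) :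
    InteriorTensor.tmul π x (c • ξ) = c • InteriorTensor.tmul π x ξ :=
  InteriorTensor.ext_inner fun z η ↦ by
    simp only [inner_smul_right, InteriorTensor.inner_tmul, map_smul]

lemma InteriorTensor.norm_tmul_le (x : X) (ξ : H) :
    ‖InteriorTensor.tmul π x ξ‖ ≤ ‖x‖ * ‖ξ‖ := by
  rw [← sq_le_sq₀ (norm_nonneg _) (by positivity), mul_pow, norm_sq_eq_norm_hinner A x,
    ← inner_self_eq_norm_sq (𝕜 := ℂ) (InteriorTensor.tmul π x ξ), InteriorTensor.inner_tmul]
  calc _ ≤ ‖ξ‖ * ‖π (hinner A x x) ξ‖ := (RCLike.re_le_norm _).trans (norm_inner_le_norm _ _)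
    _ ≤ ‖ξ‖ * (‖hinner A x x‖ * ‖ξ‖) := by
        gcongr
        exact (π (hinner A x x)).le_of_opNorm_le
          (NonUnitalStarAlgHom.norm_apply_le π (hinner A x x)) ξ
    _ = _ := by ring

/-- The bounded operator `ξ ↦ x ⊗ ξ` from `H` to `X ⊗_A H`. -/
def InteriorTensor.creation (π : A →⋆ₙₐ[ℂ] (H →L[ℂ] H)) (x : X) : H →L[ℂ] InteriorTensor X π :=
  LinearMap.mkContinuous
    { toFun := InteriorTensor.tmul π x
      map_add' := InteriorTensor.tmul_add x
      map_smul' := fun c ξ ↦ InteriorTensor.tmul_smul c x ξ } ‖x‖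
    (InteriorTensor.norm_tmul_le x)

lemma InteriorTensor.creation_apply (x : X) (ξ : H) :
    InteriorTensor.creation π x ξ = InteriorTensor.tmul π x ξ := rfl

lemma InteriorTensor.norm_creation_le (x : X) : ‖InteriorTensor.creation π x‖ ≤ ‖x‖ :=
  LinearMap.mkContinuous_norm_le _ (norm_nonneg _) _

lemma InteriorTensor.exists_map (T : Adjointable A X) :
    ∃ S : InteriorTensor X π →L[ℂ] InteriorTensor X π,
      ∀ x ξ, S (InteriorTensor.tmul π x ξ) = InteriorTensor.tmul π (T x) ξ := by
  obtain ⟨S, hS, -⟩ := KernelSpace.exists_map (K := interiorKernel X π) (hK := interiorKernel_psd π)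
    (K' := interiorKernel X π) (hK' := interiorKernel_psd π) (fun s ↦ (T s.1, s.2))
    (fun s ↦ ((star T) s.1, s.2)) (fun s t ↦ by
      simp only [interiorKernel, Adjointable.hinner_apply_left])
    (max ‖T.toCLM‖ ‖(star T).toCLM‖) (by positivity) (fun s ↦ ⟨‖s.1‖ * ‖s.2‖, fun n ↦ by
      set M := max ‖T.toCLM‖ ‖(star T).toCLM‖
      have hM1 : ‖T.toCLM‖ ≤ M := le_max_left _ _
      have hM2 : ‖(star T).toCLM‖ ≤ M := le_max_right _ _
      have h1 : ∀ n, ((fun z : X × H ↦ ((star T) (T z.1), z.2))^[n] s).2 = s.2 := by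
        intro n
        induction n with
        | zero => rfl
        | succ n ih => rw [Function.iterate_succ_apply', ih]
      have h2 : ∀ n, ‖((fun z : X × H ↦ ((star T) (T z.1), z.2))^[n] s).1‖ ≤
          (M ^ 2) ^ n * ‖s.1‖ := by
        intro n
        induction n with
        | zero => simp
        | succ n ih =>
          rw [Function.iterate_succ_apply']
          calc _ ≤ M * (M * ‖((fun z : X × H ↦ ((star T) (T z.1), z.2))^[n] s).1‖) :=
                ((star T).toCLM.le_of_opNorm_le hM2 _).trans
                  (by gcongr; exact T.toCLM.le_of_opNorm_le hM1 _)
            _ ≤ M * (M * ((M ^ 2) ^ n * ‖s.1‖)) := by gcongr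
            _ = _ := by ring
      refine (InteriorTensor.norm_tmul_le (π := π) _ _).trans ?_
      rw [h1]
      calc _ ≤ (M ^ 2) ^ n * ‖s.1‖ * ‖s.2‖ := by gcongr; exact h2 n
        _ = _ := by ring⟩)
  exact ⟨S, fun x ξ ↦ hS (x, ξ)⟩

/-- The bounded operator `T ⊗ 1` on `X ⊗_A H`, `x ⊗ ξ ↦ T x ⊗ ξ`, for adjointable `T`. -/
def InteriorTensor.map (π : A →⋆ₙₐ[ℂ] (H →L[ℂ] H)) (T : Adjointable A X) :
    InteriorTensor X π →L[ℂ] InteriorTensor X π :=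
  (InteriorTensor.exists_map T).choose

lemma InteriorTensor.map_tmul (T : Adjointable A X) (x : X) (ξ : H) :
    InteriorTensor.map π T (InteriorTensor.tmul π x ξ) = InteriorTensor.tmul π (T x) ξ :=
  (InteriorTensor.exists_map T).choose_spec x ξ

/-- The `*`-representation `T ↦ T ⊗ 1` of `End*_A(X)` on `X ⊗_A H`. -/
def InteriorTensor.mapHom (π : A →⋆ₙₐ[ℂ] (H →L[ℂ] H)) :
    Adjointable A X →⋆ₙₐ[ℂ] (InteriorTensor X π →L[ℂ] InteriorTensor X π) where
  toFun := InteriorTensor.map π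
  map_smul' c T := InteriorTensor.clm_ext fun x ξ ↦ by
    simp [InteriorTensor.map_tmul, InteriorTensor.smul_tmul]
  map_zero' := InteriorTensor.clm_ext fun x ξ ↦ by
    have : InteriorTensor.tmul π (0 : X) ξ = 0 := by
      simpa using InteriorTensor.smul_tmul (π := π) 0 (0 : X) ξ
    rw [InteriorTensor.map_tmul]
    simpa using this
  map_add' T R := InteriorTensor.clm_ext fun x ξ ↦ by
    simp [InteriorTensor.map_tmul, InteriorTensor.add_tmul]
  map_mul' T R := InteriorTensor.clm_ext fun x ξ ↦ by
    simp [InteriorTensor.map_tmul]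
  map_star' T := InteriorTensor.clm_ext fun x ξ ↦ InteriorTensor.ext_inner fun y η ↦ by
    rw [ContinuousLinearMap.star_eq_adjoint, ContinuousLinearMap.adjoint_inner_right,
      InteriorTensor.map_tmul, InteriorTensor.map_tmul, InteriorTensor.inner_tmul,
      InteriorTensor.inner_tmul, Adjointable.hinner_apply_left]

/-- The representation of `A'` on `X ⊗_A H` induced from a left action `α : A' → End*_A(X)`, that
is, from the `(A', A)`-correspondence `X`. -/
def inducedRep {A' : Type*} [NonUnitalCStarAlgebra A'] (α : A' →⋆ₙₐ[ℂ] Adjointable A X)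
    (π : A →⋆ₙₐ[ℂ] (H →L[ℂ] H)) : A' →⋆ₙₐ[ℂ] (InteriorTensor X π →L[ℂ] InteriorTensor X π) :=
  (InteriorTensor.mapHom π).comp α

lemma inducedRep_tmul {A' : Type*} [NonUnitalCStarAlgebra A'] (α : A' →⋆ₙₐ[ℂ] Adjointable A X)
    (a' : A') (x : X) (ξ : H) :
    inducedRep α π a' (InteriorTensor.tmul π x ξ) = InteriorTensor.tmul π (α a' x) ξ :=
  InteriorTensor.map_tmul (α a') x ξ

end Interior

/-! ### Restricted tensor products of `C*`-algebras -/

section Algebra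

open scoped ENNReal

variable {I : Type w} {A : I → Type u} [∀ v, NonUnitalCStarAlgebra (A v)]

/-- Distinguished projections `p_v ∈ A_v`, nonzero at almost all places. -/
structure ProjectionFamily (A : I → Type u) [∀ v, NonUnitalCStarAlgebra (A v)] where
  proj : ∀ v, A v
  isStarProjection : ∀ v, IsStarProjection (proj v)
  ne_zero : ∀ᶠ v in cofinite, proj v ≠ 0

/-- The data of a factorizable representation of the restricted tensor product of `(A_v, p_v)`:
representations `π_v` of `A_v` on Hilbert spaces `H_v` and vectors `h_v ∈ H_v` which at almost all
places are unit vectors with `π_v(p_v) h_v = h_v`. -/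
structure FactorRep (P : ProjectionFamily A) where
  space : I → Type u
  [normedAddCommGroup : ∀ v, NormedAddCommGroup (space v)]
  [innerProductSpace : ∀ v, InnerProductSpace ℂ (space v)]
  [completeSpace : ∀ v, CompleteSpace (space v)]
  rep : ∀ v, A v →⋆ₙₐ[ℂ] (space v →L[ℂ] space v)
  vec : UnitFamily space
  rep_proj : ∀ᶠ v in cofinite, rep v (P.proj v) (vec.vec v) = vec.vec v

attribute [instance] FactorRep.normedAddCommGroup FactorRep.innerProductSpace
  FactorRep.completeSpace

lemma norm_projection_le {B : Type*} [NonUnitalCStarAlgebra B] {p : B} (hp : IsStarProjection p) :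
    ‖p‖ ≤ 1 := by
  have h := CStarRing.norm_star_mul_self (x := p)
  rw [hp.isSelfAdjoint.star_eq, hp.isIdempotentElem.eq] at h
  nlinarith [norm_nonneg p]

/-- The simple tensors of `⊗' (A_v, p_v)` are closed under multiplication. -/
def ProjectionFamily.mul (P : ProjectionFamily A) (a b : RestrictedFamily A P.proj) :
    RestrictedFamily A P.proj :=
  RestrictedFamily.map₂ (fun _ ↦ (· * ·))
    (Eventually.of_forall fun v ↦ (P.isStarProjection v).isIdempotentElem) a b

/-- The simple tensors of `⊗' (A_v, p_v)` are closed under the involution. -/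
def ProjectionFamily.star (P : ProjectionFamily A) (a : RestrictedFamily A P.proj) :
    RestrictedFamily A P.proj :=
  RestrictedFamily.map (fun _ ↦ Star.star)
    (Eventually.of_forall fun v ↦ (P.isStarProjection v).isSelfAdjoint) a

variable {P : ProjectionFamily A}

lemma FactorRep.op_aux (R : FactorRep P) (a : RestrictedFamily A P.proj) :
    ∀ᶠ v in cofinite, R.rep v (a v) (R.vec.vec v) = R.vec.vec v ∧ ‖R.rep v (a v)‖ ≤ 1 := by
  filter_upwards [R.rep_proj, a.2] with v h1 h2
  rw [h2]
  exact ⟨h1, (NonUnitalStarAlgHom.norm_apply_le (R.rep v) _).trans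
    (norm_projection_le (P.isStarProjection v))⟩

/-- The operator `⊗ π_v(a_v)` on `⊗' (H_v, h_v)`. -/
def FactorRep.op (R : FactorRep P) (a : RestrictedFamily A P.proj) :
    HilbertTensor R.vec →L[ℂ] HilbertTensor R.vec :=
  HilbertTensor.map (fun v ↦ R.rep v (a v)) (R.op_aux a)

lemma FactorRep.op_tprod_aux (R : FactorRep P) (a : RestrictedFamily A P.proj) :
    ∀ᶠ v in cofinite, R.rep v (a v) (R.vec.vec v) = R.vec.vec v :=
  (R.op_aux a).mono fun _ h ↦ h.1

lemma FactorRep.op_tprod (R : FactorRep P) (a : RestrictedFamily A P.proj)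
    (e : RestrictedFamily R.space R.vec.vec) :
    R.op a (HilbertTensor.tprod _ e) = HilbertTensor.tprod _
      (e.map (fun v ↦ R.rep v (a v)) (R.op_tprod_aux a)) :=
  HilbertTensor.map_tprod _ _ e

lemma FactorRep.norm_op_le (R : FactorRep P) (a : RestrictedFamily A P.proj) :
    ‖R.op a‖ ≤ ∏ᶠ v, max 1 ‖a v‖ := by
  refine (HilbertTensor.norm_map_le _ _).trans ?_
  have h2 : ∀ᶠ v in cofinite, ‖a v‖ ≤ 1 := by
    filter_upwards [a.2] with v h
    rw [h]; exact norm_projection_le (P.isStarProjection v)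
  have hfin := eventually_cofinite.mp h2
  have hnot : ∀ v, v ∉ hfin.toFinset → ‖a v‖ ≤ 1 := fun v hv ↦ by simpa using hv
  have hle : ∀ v, ‖R.rep v (a v)‖ ≤ ‖a v‖ := fun v ↦ NonUnitalStarAlgHom.norm_apply_le (R.rep v) _
  rw [finprod_eq_prod_of_mulSupport_subset (s := hfin.toFinset),
    finprod_eq_prod_of_mulSupport_subset (s := hfin.toFinset)]
  · exact Finset.prod_le_prod (fun _ _ ↦ by positivity) fun v _ ↦ max_le_max le_rfl (hle v)
  · intro v hv
    by_contra h
    exact hv (max_eq_left (hnot v h))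
  · intro v hv
    by_contra h
    exact hv (max_eq_left ((hle v).trans (hnot v h)))

lemma FactorRep.op_mul (R : FactorRep P) (a b : RestrictedFamily A P.proj) :
    R.op (P.mul a b) = R.op a * R.op b := by
  refine KernelSpace.clm_ext fun e ↦ ?_
  change R.op (P.mul a b) (HilbertTensor.tprod _ e) = R.op a (R.op b (HilbertTensor.tprod _ e))
  rw [FactorRep.op_tprod, FactorRep.op_tprod, FactorRep.op_tprod]
  congr 1
  refine Subtype.ext (funext fun v ↦ ?_)
  simp [RestrictedFamily.map, RestrictedFamily.map₂, ProjectionFamily.mul]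

lemma FactorRep.op_star (R : FactorRep P) (a : RestrictedFamily A P.proj) :
    R.op (P.star a) = star (R.op a) := by
  rw [ContinuousLinearMap.star_eq_adjoint, FactorRep.op, FactorRep.op,
    HilbertTensor.adjoint_map _ _ (adjoint_eventually _ (R.op_aux a))]
  congr 1
  funext v
  simp [RestrictedFamily.map, ProjectionFamily.star, map_star, ContinuousLinearMap.star_eq_adjoint]

/-- The `C*`-algebra of bounded families of operators indexed by all factorizable
representations. -/
def BoundedOperatorFamilies (P : ProjectionFamily A) : Type (max w (u + 1)) :=
  lp (fun R : FactorRep P ↦ (HilbertTensor R.vec →L[ℂ] HilbertTensor R.vec)) ∞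

instance : NonUnitalCStarAlgebra (BoundedOperatorFamilies P) :=
  inferInstanceAs (NonUnitalCStarAlgebra
    (lp (fun R : FactorRep P ↦ (HilbertTensor R.vec →L[ℂ] HilbertTensor R.vec)) ∞))

/-- The component at the representation `R` of a family of operators. -/
def BoundedOperatorFamilies.eval (a : BoundedOperatorFamilies P) (R : FactorRep P) :
    HilbertTensor R.vec →L[ℂ] HilbertTensor R.vec :=
  (show lp (fun R : FactorRep P ↦ (HilbertTensor R.vec →L[ℂ] HilbertTensor R.vec)) ∞ from a) R

/-- The simple tensor `⊗ a_v`, as the family of the operators `⊗ π_v(a_v)` on `⊗' (H_v, h_v)`. -/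
def ProjectionFamily.simpleTensor (P : ProjectionFamily A) (a : RestrictedFamily A P.proj) :
    BoundedOperatorFamilies P :=
  ⟨fun R ↦ R.op a, memℓp_infty ⟨∏ᶠ v, max 1 ‖a v‖, by rintro _ ⟨R, rfl⟩; exact R.norm_op_le a⟩⟩

/-- The restricted (spatial) tensor product `⊗' (A_v, p_v)`: the closed `*`-algebra generated by
(equivalently, the closed linear span of) the simple tensors `⊗ a_v`, `a_v = p_v` for almost all
`v`, in the norm `‖a‖ = sup ‖(⊗ π_v)(a)‖` over all families of representations `π_v` of `A_v` on
Hilbert spaces `H_v` together with vectors `h_v` that are unit vectors fixed by `π_v(p_v)` at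
almost all places.

This is the inductive limit of the spatial tensor products `A_S` over finite sets `S` containing
all `v` with `p_v = 0`, along `a ↦ a ⊗ p_v`: for `a ∈ A_S` the operator assigned to
`a ⊗ (⊗ p_v)` is `(⊗_{v ∈ S} π_v)(a)` tensored with `⊗'_{v ∉ S} π_v(p_v)`, an operator of norm at
most one, and of norm one if `π_v(p_v) ≠ 0` for all `v ∉ S`. So the supremum is the one of
`‖(⊗_{v ∈ S} π_v)(a)‖` over all representations `π_v` of `A_v`, `v ∈ S`, which is the spatial
norm. -/
def AlgTensor (P : ProjectionFamily A) : Type (max w (u + 1)) :=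
  (NonUnitalStarAlgebra.adjoin ℂ (Set.range P.simpleTensor)).topologicalClosure

instance : NonUnitalCStarAlgebra (AlgTensor P) :=
  NonUnitalStarSubalgebra.nonUnitalCStarAlgebra
    (NonUnitalStarAlgebra.adjoin ℂ (Set.range P.simpleTensor)).topologicalClosure
    (h_closed := NonUnitalStarSubalgebra.isClosed_topologicalClosure _)

/-- The simple tensor `⊗ a_v` in `⊗' (A_v, p_v)`. -/
def AlgTensor.tprod (P : ProjectionFamily A) (a : RestrictedFamily A P.proj) : AlgTensor P :=
  ⟨P.simpleTensor a, NonUnitalStarSubalgebra.le_topologicalClosure _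
    (NonUnitalStarAlgebra.subset_adjoin ℂ _ ⟨a, rfl⟩)⟩

/-- The factorizable representation `⊗' π_v` of `⊗' (A_v, p_v)` on `⊗' (H_v, h_v)`. It is the
unique one with `⊗ a_v` acting as `⊗ π_v(a_v)`. -/
def FactorRep.tensorRep (R : FactorRep P) :
    AlgTensor P →⋆ₙₐ[ℂ] (HilbertTensor R.vec →L[ℂ] HilbertTensor R.vec) where
  toFun a := BoundedOperatorFamilies.eval a.1 R
  map_smul' _ _ := rfl
  map_zero' := rfl
  map_add' _ _ := rfl
  map_mul' _ _ := rfl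
  map_star' _ := rfl

lemma FactorRep.tensorRep_tprod (R : FactorRep P) (a : RestrictedFamily A P.proj) :
    R.tensorRep (AlgTensor.tprod P a) = R.op a := rfl

lemma AlgTensor.ext_rep {a b : AlgTensor P} (h : ∀ R : FactorRep P, R.tensorRep a = R.tensorRep b) :
    a = b :=
  by
  refine Subtype.ext ?_
  exact lp.ext (E := fun R : FactorRep P ↦ (HilbertTensor R.vec →L[ℂ] HilbertTensor R.vec))
    (funext h)

lemma AlgTensor.norm_le {a : AlgTensor P} {C : ℝ} (hC : 0 ≤ C)
    (h : ∀ R : FactorRep P, ‖R.tensorRep a‖ ≤ C) : ‖a‖ ≤ C :=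
  lp.norm_le_of_forall_le
    (E := fun R : FactorRep P ↦ (HilbertTensor R.vec →L[ℂ] HilbertTensor R.vec)) (f := a.1) hC h

lemma AlgTensor.tprod_mul (a b : RestrictedFamily A P.proj) :
    AlgTensor.tprod P (P.mul a b) = AlgTensor.tprod P a * AlgTensor.tprod P b :=
  AlgTensor.ext_rep fun R ↦ by
    rw [map_mul, FactorRep.tensorRep_tprod, FactorRep.tensorRep_tprod, FactorRep.tensorRep_tprod,
      FactorRep.op_mul]

lemma AlgTensor.tprod_star (a : RestrictedFamily A P.proj) :
    AlgTensor.tprod P (P.star a) = star (AlgTensor.tprod P a) :=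
  AlgTensor.ext_rep fun R ↦ by
    rw [map_star, FactorRep.tensorRep_tprod, FactorRep.tensorRep_tprod, FactorRep.op_star]

/-- The inclusion of `⊗' (A_v, p_v)` into the bounded families of operators, as a linear map. -/
def AlgTensor.incl (P : ProjectionFamily A) : AlgTensor P →ₗ[ℂ] BoundedOperatorFamilies P where
  toFun a := a.1
  map_add' _ _ := rfl
  map_smul' _ _ := rfl

lemma ProjectionFamily.adjoin_le_span (P : ProjectionFamily A) :
    (NonUnitalStarAlgebra.adjoin ℂ (Set.range P.simpleTensor)).toSubmodule ≤
      Submodule.span ℂ (Set.range P.simpleTensor) := by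
  rw [NonUnitalStarAlgebra.adjoin_eq_span]
  refine Submodule.span_mono ?_
  let T : Subsemigroup (BoundedOperatorFamilies P) :=
    { carrier := Set.range P.simpleTensor
      mul_mem' := by
        rintro _ _ ⟨a, rfl⟩ ⟨b, rfl⟩
        exact ⟨P.mul a b, congrArg (AlgTensor.incl P) (AlgTensor.tprod_mul a b)⟩ }
  have h : Subsemigroup.closure (Set.range P.simpleTensor ∪ Star.star (Set.range P.simpleTensor)) ≤
      T := by
    rw [Subsemigroup.closure_le]
    rintro x (hx | ⟨a, ha⟩)
    · exact hx
    · refine ⟨P.star a, ?_⟩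
      have h2 : P.simpleTensor (P.star a) = Star.star (P.simpleTensor a) :=
        congrArg (AlgTensor.incl P) (AlgTensor.tprod_star a)
      rw [h2, ha, star_star]
  exact h

lemma AlgTensor.mem_closure_span (a : AlgTensor P) :
    a ∈ closure (Submodule.span ℂ (Set.range (AlgTensor.tprod P)) : Set (AlgTensor P)) := by
  have hsub : (NonUnitalStarAlgebra.adjoin ℂ (Set.range P.simpleTensor) :
      Set (BoundedOperatorFamilies P)) ⊆
      AlgTensor.incl P '' (Submodule.span ℂ (Set.range (AlgTensor.tprod P)) : Set (AlgTensor P)) := by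
    intro x hx
    have hx' := P.adjoin_le_span hx
    have h2 : Set.range P.simpleTensor = AlgTensor.incl P '' Set.range (AlgTensor.tprod P) := by
      rw [← Set.range_comp]; rfl
    rw [h2, ← Submodule.map_span] at hx'
    exact hx'
  exact closure_subtype.mpr (closure_mono hsub a.2)

lemma AlgTensor.induction {p : AlgTensor P → Prop} (a : AlgTensor P) (hc : IsClosed {a | p a})
    (h0 : p 0) (h1 : ∀ a, p (AlgTensor.tprod P a)) (ha : ∀ a b, p a → p b → p (a + b))
    (hs : ∀ (c : ℂ) a, p a → p (c • a)) : p a := by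
  have hsub : (Submodule.span ℂ (Set.range (AlgTensor.tprod P)) : Set (AlgTensor P)) ⊆
      {a | p a} := fun x hx ↦
    Submodule.span_induction (p := fun x _ ↦ p x) (by rintro _ ⟨a, rfl⟩; exact h1 a) h0
      (fun x y _ _ ↦ ha x y) (fun c x _ ↦ hs c x) hx
  exact closure_minimal hsub hc (AlgTensor.mem_closure_span a)

end Algebra

/-! ### Restricted tensor products of Hilbert modules -/

section Modules

variable {I : Type w} {A : I → Type u} [∀ v, NonUnitalCStarAlgebra (A v)]
  {X : I → Type u} [∀ v, NormedAddCommGroup (X v)] [∀ v, NormedSpace ℂ (X v)]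
  [∀ v, RightHilbertModule (A v) (X v)] {P : ProjectionFamily A}

/-- Distinguished vectors `x_v ∈ X_v` which are compatible with the distinguished projections:
`⟨x_v, x_v⟩ = p_v` at almost all places. -/
structure CompatibleVectors (X : I → Type u) [∀ v, NormedAddCommGroup (X v)]
    [∀ v, NormedSpace ℂ (X v)] [∀ v, RightHilbertModule (A v) (X v)]
    (P : ProjectionFamily A) where
  vec : ∀ v, X v
  hinner_self : ∀ᶠ v in cofinite, hinner (A v) (vec v) (vec v) = P.proj v

lemma norm_le_one_of_hinner_self {B Y : Type*} [NonUnitalCStarAlgebra B] [NormedAddCommGroup Y]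
    [NormedSpace ℂ Y] [RightHilbertModule B Y] {p : B} (hp : IsStarProjection p) {y : Y}
    (hy : hinner B y y = p) : ‖y‖ ≤ 1 := by
  have h := norm_sq_eq_norm_hinner B y
  rw [hy] at h
  have := norm_projection_le hp
  nlinarith [norm_nonneg y]

lemma rsmul_of_hinner_self {B Y : Type*} [NonUnitalCStarAlgebra B] [NormedAddCommGroup Y]
    [NormedSpace ℂ Y] [RightHilbertModule B Y] {p : B} (hp : IsStarProjection p) {y : Y}
    (hy : hinner B y y = p) : rsmul y p = y := by
  have h : ‖y - rsmul y p‖ ^ 2 = 0 := by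
    have h1 : hinner B (y - rsmul y p) (y - rsmul y p) = 0 := by
      have h2 : ∀ z, hinner B (y - rsmul y p) z = hinner B y z - p * hinner B y z := fun z ↦ by
        rw [← star_hinner, hinner_sub_right, hinner_rsmul_right, star_sub, star_mul, star_hinner,
          hp.isSelfAdjoint.star_eq]
      rw [h2, hinner_sub_right, hinner_rsmul_right, hy, hp.isIdempotentElem.eq, sub_self, mul_zero,
        sub_zero]
    rw [norm_sq_eq_norm_hinner B, h1, norm_zero]
  exact (sub_eq_zero.mp (norm_eq_zero.mp (pow_eq_zero_iff two_ne_zero |>.mp h))).symm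

variable (x : CompatibleVectors X P)

/-- The family of inner products `(⟨w_v, z_v⟩)`. -/
def CompatibleVectors.inner (w z : RestrictedFamily X x.vec) : RestrictedFamily A P.proj :=
  RestrictedFamily.map₂ (fun v ↦ hinner (A v)) x.hinner_self w z

/-- The family `(w_v a_v)`. -/
def CompatibleVectors.rsmul (w : RestrictedFamily X x.vec) (a : RestrictedFamily A P.proj) :
    RestrictedFamily X x.vec :=
  RestrictedFamily.map₂ (fun _ ↦ RTensor.rsmul)
    (x.hinner_self.mono fun v h ↦ rsmul_of_hinner_self (P.isStarProjection v) h) w a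

lemma CompatibleVectors.inner_rsmul (w z : RestrictedFamily X x.vec)
    (a : RestrictedFamily A P.proj) : x.inner w (x.rsmul z a) = P.mul (x.inner w z) a :=
  Subtype.ext (funext fun v ↦ hinner_rsmul_right (w v) (z v) (a v))

lemma CompatibleVectors.star_inner (w z : RestrictedFamily X x.vec) :
    P.star (x.inner w z) = x.inner z w :=
  Subtype.ext (funext fun v ↦ star_hinner (w v) (z v))

lemma FactorRep.tmul_norm_eq (R : FactorRep P) :
    ∀ᶠ v in cofinite, ‖InteriorTensor.tmul (R.rep v) (x.vec v) (R.vec.vec v)‖ = 1 := by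
  filter_upwards [x.hinner_self, R.rep_proj, R.vec.norm_eq] with v h1 h2 h3
  have h : ‖InteriorTensor.tmul (R.rep v) (x.vec v) (R.vec.vec v)‖ ^ 2 = 1 := by
    rw [← inner_self_eq_norm_sq (𝕜 := ℂ), InteriorTensor.inner_tmul, h1, h2, inner_self_eq_norm_sq,
      h3, one_pow]
  exact (pow_eq_one_iff_of_nonneg (norm_nonneg _) two_ne_zero).mp h

/-- The distinguished vectors `x_v ⊗ h_v ∈ X_v ⊗_{A_v} H_v`. -/
def FactorRep.indVec (R : FactorRep P) (x : CompatibleVectors X P) :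
    UnitFamily (fun v ↦ InteriorTensor (X v) (R.rep v)) where
  vec v := InteriorTensor.tmul (R.rep v) (x.vec v) (R.vec.vec v)
  norm_eq := R.tmul_norm_eq x

/-- The family `(w_v ⊗ y_v)` of elementary tensors in `X_v ⊗_{A_v} H_v`. -/
def FactorRep.pair (R : FactorRep P) (x : CompatibleVectors X P) (w : RestrictedFamily X x.vec)
    (y : RestrictedFamily R.space R.vec.vec) :
    RestrictedFamily (fun v ↦ InteriorTensor (X v) (R.rep v)) (R.indVec x).vec :=
  RestrictedFamily.map₂ (fun v ↦ InteriorTensor.tmul (R.rep v)) (Eventually.of_forall fun _ ↦ rfl)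
    w y

lemma FactorRep.creation_aux (R : FactorRep P) (w : RestrictedFamily X x.vec) :
    ∀ᶠ v in cofinite,
      InteriorTensor.creation (R.rep v) (w v) (R.vec.vec v) = (R.indVec x).vec v ∧
        ‖InteriorTensor.creation (R.rep v) (w v)‖ ≤ 1 := by
  filter_upwards [x.hinner_self, w.2] with v h1 h2
  rw [h2]
  exact ⟨rfl, (InteriorTensor.norm_creation_le _).trans
    (norm_le_one_of_hinner_self (P.isStarProjection v) h1)⟩

/-- The bounded operator `⊗ y_v ↦ ⊗ (w_v ⊗ y_v)`. -/
def FactorRep.creation (R : FactorRep P) (x : CompatibleVectors X P)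
    (w : RestrictedFamily X x.vec) : HilbertTensor R.vec →L[ℂ] HilbertTensor (R.indVec x) :=
  HilbertTensor.map (fun v ↦ InteriorTensor.creation (R.rep v) (w v)) (R.creation_aux x w)

lemma adjoint_creation_comp {B Y H : Type*} [NonUnitalCStarAlgebra B] [NormedAddCommGroup Y]
    [NormedSpace ℂ Y] [RightHilbertModule B Y] [NormedAddCommGroup H] [InnerProductSpace ℂ H]
    [CompleteSpace H] (π : B →⋆ₙₐ[ℂ] (H →L[ℂ] H)) (y z : Y) :
    (InteriorTensor.creation π y).adjoint ∘L InteriorTensor.creation π z = π (hinner B y z) := by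
  ext ξ
  refine ext_inner_left ℂ fun η ↦ ?_
  rw [ContinuousLinearMap.comp_apply, ContinuousLinearMap.adjoint_inner_right,
    InteriorTensor.creation_apply, InteriorTensor.creation_apply, InteriorTensor.inner_tmul]

lemma FactorRep.adjoint_creation_comp (R : FactorRep P) (w z : RestrictedFamily X x.vec) :
    (R.creation x w).adjoint ∘L R.creation x z = R.op (x.inner w z) := by
  rw [FactorRep.creation, FactorRep.creation,
    HilbertTensor.adjoint_map _ _ (adjoint_eventually _ (R.creation_aux x w))]
  have h : ∀ v, (InteriorTensor.creation (R.rep v) (w v)).adjoint ∘L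
      InteriorTensor.creation (R.rep v) (z v) = R.rep v (x.inner w z v) := fun v ↦
    RTensor.adjoint_creation_comp (R.rep v) (w v) (z v)
  rw [← HilbertTensor.map_comp _ _ _ _ (by simp only [h]; exact R.op_aux _)]
  simp only [h]
  rfl

/-- The free complex vector space on the families `(w_v)` with `w_v = x_v` for almost all `v`,
spanned by symbols `⊗ w_v`. -/
def ModPre (x : CompatibleVectors X P) : Type (max u w) := RestrictedFamily X x.vec →₀ ℂ

instance : AddCommGroup (ModPre x) := inferInstanceAs (AddCommGroup (RestrictedFamily X x.vec →₀ ℂ))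
instance : Module ℂ (ModPre x) := inferInstanceAs (Module ℂ (RestrictedFamily X x.vec →₀ ℂ))

/-- The symbol `⊗ w_v`. -/
def ModPre.single (w : RestrictedFamily X x.vec) : ModPre x := Finsupp.single w (1 : ℂ)

variable {x} in
lemma ModPre.induction {p : ModPre x → Prop} (ζ : ModPre x)
    (h0 : p 0) (h1 : ∀ w, p (ModPre.single x w)) (ha : ∀ ζ η, p ζ → p η → p (ζ + η))
    (hs : ∀ (c : ℂ) ζ, p ζ → p (c • ζ)) : p ζ := by
  refine Finsupp.induction_linear (motive := p) ζ h0 ha fun s c ↦ ?_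
  have := hs c _ (h1 s)
  have h : c • ModPre.single x s = (Finsupp.single s c : RestrictedFamily X x.vec →₀ ℂ) := by
    change c • (Finsupp.single s (1 : ℂ)) = Finsupp.single s c
    simp
  exact h ▸ this

/-- The `A`-valued semi-inner product with `⟨⊗ w_v, ⊗ z_v⟩ = ⊗ ⟨w_v, z_v⟩`. -/
def ModPre.form (ζ η : ModPre x) : AlgTensor P :=
  Finsupp.sum (show RestrictedFamily X x.vec →₀ ℂ from ζ) fun w c ↦
    Finsupp.sum (show RestrictedFamily X x.vec →₀ ℂ from η) fun z d ↦
      (star c * d) • AlgTensor.tprod P (x.inner w z)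

/-- The creation operators extended linearly. -/
def FactorRep.loc (R : FactorRep P) (x : CompatibleVectors X P) :
    ModPre x →ₗ[ℂ] (HilbertTensor R.vec →L[ℂ] HilbertTensor (R.indVec x)) :=
  Finsupp.linearCombination ℂ (R.creation x)

lemma FactorRep.loc_single (R : FactorRep P) (w : RestrictedFamily X x.vec) :
    R.loc x (ModPre.single x w) = R.creation x w :=
  (Finsupp.linearCombination_single ℂ (1 : ℂ) w).trans (one_smul _ _)

variable {x}

lemma FactorRep.tensorRep_form (R : FactorRep P) (ζ η : ModPre x) :
    R.tensorRep (ModPre.form x ζ η) = (R.loc x ζ).adjoint ∘L R.loc x η := by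
  have h : ∀ ζ : RestrictedFamily X x.vec →₀ ℂ, R.loc x ζ = ζ.sum fun w c ↦ c • R.creation x w :=
    fun _ ↦ rfl
  rw [ModPre.form, h ζ, h η]
  simp only [Finsupp.sum, map_sum, map_smul, FactorRep.tensorRep_tprod,
    ← FactorRep.adjoint_creation_comp, LinearIsometryEquiv.map_smulₛₗ]
  ext ξ
  simp only [sum_apply, smul_apply, ContinuousLinearMap.comp_apply, map_sum, map_smul, mul_smul,
    Finset.smul_sum]
  rw [Finset.sum_comm]
  exact Finset.sum_congr rfl fun w _ ↦ Finset.sum_congr rfl fun z _ ↦ smul_comm _ _ _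

lemma ModPre.form_add_right (ζ η θ : ModPre x) :
    ModPre.form x ζ (η + θ) = ModPre.form x ζ η + ModPre.form x ζ θ :=
  AlgTensor.ext_rep fun R ↦ by
    simp only [map_add, FactorRep.tensorRep_form, ContinuousLinearMap.comp_add]

lemma ModPre.form_smul_right (c : ℂ) (ζ η : ModPre x) :
    ModPre.form x ζ (c • η) = c • ModPre.form x ζ η :=
  AlgTensor.ext_rep fun R ↦ by
    simp only [map_smul, FactorRep.tensorRep_form, ContinuousLinearMap.comp_smul]

lemma ModPre.star_form (ζ η : ModPre x) : star (ModPre.form x ζ η) = ModPre.form x η ζ :=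
  AlgTensor.ext_rep fun R ↦ by
    rw [map_star, FactorRep.tensorRep_form, FactorRep.tensorRep_form,
      ContinuousLinearMap.star_eq_adjoint, ContinuousLinearMap.adjoint_comp,
      ContinuousLinearMap.adjoint_adjoint]

lemma ModPre.form_add_left (ζ η θ : ModPre x) :
    ModPre.form x (ζ + η) θ = ModPre.form x ζ θ + ModPre.form x η θ := by
  rw [← ModPre.star_form, ModPre.form_add_right, star_add, ModPre.star_form, ModPre.star_form]

lemma ModPre.form_smul_left (c : ℂ) (ζ η : ModPre x) :
    ModPre.form x (c • ζ) η = star c • ModPre.form x ζ η := by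
  rw [← ModPre.star_form, ModPre.form_smul_right, star_smul, ModPre.star_form]

lemma ModPre.form_single (w z : RestrictedFamily X x.vec) :
    ModPre.form x (ModPre.single x w) (ModPre.single x z) = AlgTensor.tprod P (x.inner w z) :=
  AlgTensor.ext_rep fun R ↦ by
    rw [FactorRep.tensorRep_form, FactorRep.loc_single, FactorRep.loc_single,
      FactorRep.adjoint_creation_comp, FactorRep.tensorRep_tprod]

instance : Norm (ModPre x) := ⟨fun ζ ↦ √‖ModPre.form x ζ ζ‖⟩

lemma ModPre.norm_sq_eq (ζ : ModPre x) : ‖ζ‖ ^ 2 = ‖ModPre.form x ζ ζ‖ :=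
  Real.sq_sqrt (norm_nonneg _)

lemma ModPre.norm_nonneg' (ζ : ModPre x) : 0 ≤ ‖ζ‖ := Real.sqrt_nonneg _

lemma FactorRep.norm_loc_le (R : FactorRep P) (ζ : ModPre x) : ‖R.loc x ζ‖ ≤ ‖ζ‖ := by
  rw [← sq_le_sq₀ (norm_nonneg _) ζ.norm_nonneg', ModPre.norm_sq_eq, sq,
    ← ContinuousLinearMap.norm_adjoint_comp_self, ← FactorRep.tensorRep_form]
  exact NonUnitalStarAlgHom.norm_apply_le R.tensorRep _

lemma ModPre.norm_form_le (ζ η : ModPre x) : ‖ModPre.form x ζ η‖ ≤ ‖ζ‖ * ‖η‖ := by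
  refine AlgTensor.norm_le (mul_nonneg ζ.norm_nonneg' η.norm_nonneg') fun R ↦ ?_
  rw [FactorRep.tensorRep_form]
  refine (ContinuousLinearMap.opNorm_comp_le _ _).trans ?_
  rw [LinearIsometryEquiv.norm_map]
  exact mul_le_mul (R.norm_loc_le ζ) (R.norm_loc_le η) (norm_nonneg _) ζ.norm_nonneg'

lemma ModPre.core (x : CompatibleVectors X P) : SeminormedSpace.Core ℂ (ModPre x) where
  norm_nonneg := ModPre.norm_nonneg'
  norm_smul c ζ := by
    rw [← sq_eq_sq₀ (ModPre.norm_nonneg' _) (mul_nonneg (norm_nonneg c) ζ.norm_nonneg'), mul_pow,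
      ModPre.norm_sq_eq, ModPre.norm_sq_eq, ModPre.form_smul_left, ModPre.form_smul_right,
      norm_smul, norm_smul, norm_star]
    ring
  norm_triangle ζ η := by
    rw [← sq_le_sq₀ (ModPre.norm_nonneg' _) (add_nonneg ζ.norm_nonneg' η.norm_nonneg'),
      ModPre.norm_sq_eq, ModPre.form_add_left, ModPre.form_add_right, ModPre.form_add_right]
    have h1 := ModPre.norm_form_le ζ ζ
    have h2 := ModPre.norm_form_le ζ η
    have h3 := ModPre.norm_form_le η ζ
    have h4 := ModPre.norm_form_le η η
    have h5 := norm_add₃_le (a := ModPre.form x ζ ζ) (b := ModPre.form x ζ η)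
      (c := ModPre.form x η ζ + ModPre.form x η η)
    have h6 := norm_add_le (ModPre.form x η ζ) (ModPre.form x η η)
    rw [← add_assoc] at h5
    rw [← add_assoc]
    nlinarith

instance : SeminormedAddCommGroup (ModPre x) := SeminormedAddCommGroup.ofCore (ModPre.core x)
instance : NormedSpace ℂ (ModPre x) := ⟨fun c ζ ↦ ((ModPre.core x).norm_smul c ζ).le⟩

/-- Positivity in `⊗' (A_v, p_v)` can be tested in the factorizable representations. -/
lemma AlgTensor.nonneg_of_rep [PartialOrder (AlgTensor P)] [StarOrderedRing (AlgTensor P)]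
    (G : AlgTensor P) (hG : IsSelfAdjoint G)
    (h : ∀ (R : FactorRep P) (ξ : HilbertTensor R.vec), 0 ≤ (⟪ξ, R.tensorRep G ξ⟫_ℂ).re) :
    0 ≤ G := by
  obtain ⟨N, hN0, hNGN, hNG⟩ := exists_negPart G hG
  have hNsa : star N = N := (IsSelfAdjoint.of_nonneg hN0).star_eq
  obtain ⟨b, hb⟩ := exists_star_mul_self hN0
  have hM0 : b * N = 0 := by
    refine AlgTensor.ext_rep fun R ↦ ?_
    rw [map_zero]
    ext1 ξ
    have h1 : ⟪R.tensorRep N ξ, R.tensorRep G (R.tensorRep N ξ)⟫_ℂ =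
        -⟪R.tensorRep (b * N) ξ, R.tensorRep (b * N) ξ⟫_ℂ := by
      have e1 : ⟪R.tensorRep N ξ, R.tensorRep G (R.tensorRep N ξ)⟫_ℂ =
          ⟪ξ, R.tensorRep (N * G * N) ξ⟫_ℂ := by
        nth_rewrite 1 [← hNsa]
        rw [map_star, ContinuousLinearMap.star_eq_adjoint, ContinuousLinearMap.adjoint_inner_left,
          map_mul, map_mul]
        rfl
      have e2 : ⟪R.tensorRep (b * N) ξ, R.tensorRep (b * N) ξ⟫_ℂ =
          ⟪ξ, R.tensorRep (N * N * N) ξ⟫_ℂ := by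
        have : N * N * N = star (b * N) * (b * N) := by
          rw [star_mul, hNsa]
          calc N * N * N = N * (star b * b) * N := by rw [← hb]
            _ = _ := by simp only [mul_assoc]
        rw [this, map_mul R.tensorRep (star (b * N)), map_star, ContinuousLinearMap.star_eq_adjoint,
          mul_apply_eq_comp, ContinuousLinearMap.adjoint_inner_right]
      rw [e1, e2, hNGN, map_neg, neg_apply, inner_neg_right]
    have h2 := h R (R.tensorRep N ξ)
    rw [h1, Complex.neg_re] at h2
    have h3 : ‖R.tensorRep (b * N) ξ‖ ^ 2 ≤ 0 := by
      rw [← inner_self_eq_norm_sq (𝕜 := ℂ)]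
      exact neg_nonneg.mp h2
    have h4 := le_antisymm h3 (sq_nonneg _)
    exact norm_eq_zero.mp (pow_eq_zero_iff two_ne_zero |>.mp h4)
  have hNNN : N * N * N = 0 := by
    calc N * N * N = N * (star b * b) * N := by rw [← hb]
      _ = N * star b * (b * N) := by simp only [mul_assoc]
      _ = 0 := by rw [hM0, mul_zero]
  have hNN : N * N = 0 := by
    rw [← CStarRing.star_mul_self_eq_zero_iff, star_mul, hNsa]
    calc _ = N * N * N * N := by simp only [mul_assoc]
      _ = 0 := by rw [hNNN, zero_mul]
  refine hNG ?_
  rw [← CStarRing.star_mul_self_eq_zero_iff, hNsa, hNN]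

lemma ModPre.form_self_nonneg [PartialOrder (AlgTensor P)] [StarOrderedRing (AlgTensor P)]
    (ζ : ModPre x) : 0 ≤ ModPre.form x ζ ζ := by
  refine AlgTensor.nonneg_of_rep _ (ModPre.star_form ζ ζ) fun R ξ ↦ ?_
  rw [FactorRep.tensorRep_form, ContinuousLinearMap.comp_apply,
    ContinuousLinearMap.adjoint_inner_right]
  exact inner_self_nonneg (𝕜 := ℂ)

/-- The restricted tensor product `X = ⊗' (X_v, x_v)` of Hilbert modules: the (Hausdorff)
completion of the linear span of the simple tensors `⊗ w_v`, `w_v = x_v` for almost all `v`, with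
respect to the `A`-valued inner product `⟨⊗ w_v, ⊗ z_v⟩ = ⊗ ⟨w_v, z_v⟩`, `A = ⊗' (A_v, p_v)`.
(The linear relations between simple tensors are null vectors of this semi-inner product.) -/
def ModTensor (x : CompatibleVectors X P) : Type (max u w) := Completion (ModPre x)

instance : NormedAddCommGroup (ModTensor x) :=
  inferInstanceAs (NormedAddCommGroup (Completion (ModPre x)))
instance : NormedSpace ℂ (ModTensor x) := inferInstanceAs (NormedSpace ℂ (Completion (ModPre x)))
instance : CompleteSpace (ModTensor x) := inferInstanceAs (CompleteSpace (Completion (ModPre x)))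

/-- The simple tensor `⊗ w_v` in `⊗' (X_v, x_v)`. -/
def ModTensor.tprod (x : CompatibleVectors X P) (w : RestrictedFamily X x.vec) : ModTensor x :=
  (ModPre.single x w : Completion (ModPre x))

/-- The semi-inner product as a biadditive map. -/
def ModPre.formHom (x : CompatibleVectors X P) : ModPre x →+ ModPre x →+ AlgTensor P :=
  AddMonoidHom.mk' (fun ζ ↦ AddMonoidHom.mk' (ModPre.form x ζ) (ModPre.form_add_right ζ))
    fun ζ η ↦ AddMonoidHom.ext fun θ ↦ ModPre.form_add_left ζ η θ

lemma ModPre.continuous_form (x : CompatibleVectors X P) :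
    Continuous fun p : ModPre x × ModPre x ↦ ModPre.formHom x p.1 p.2 := by
  let L : ModPre x →ₗ⋆[ℂ] ModPre x →ₗ[ℂ] AlgTensor P :=
    LinearMap.mk₂'ₛₗ (starRingEnd ℂ) (RingHom.id ℂ) (ModPre.form x) ModPre.form_add_left
      ModPre.form_smul_left ModPre.form_add_right ModPre.form_smul_right
  let L' := L.mkContinuous₂ 1 (fun ζ η ↦ by
    rw [one_mul]; exact ModPre.norm_form_le ζ η)
  exact (L'.continuous.comp continuous_fst).clm_apply continuous_snd

/-- The `A`-valued inner product on `⊗' (X_v, x_v)`, extended by continuity. -/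
def ModTensor.inner (ζ η : ModTensor x) : AlgTensor P :=
  ((Completion.isDenseInducing_toCompl (ModPre x)).prodMap
    (Completion.isDenseInducing_toCompl (ModPre x))).extend
      (fun p : ModPre x × ModPre x ↦ ModPre.formHom x p.1 p.2) (ζ, η)

lemma ModTensor.continuous_inner : Continuous fun p : ModTensor x × ModTensor x ↦
    ModTensor.inner p.1 p.2 :=
  (Completion.isDenseInducing_toCompl (ModPre x)).extend_Z_bilin
    (Completion.isDenseInducing_toCompl (ModPre x)) (ModPre.continuous_form x)

lemma ModTensor.inner_coe (ζ η : ModPre x) :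
    ModTensor.inner (ζ : Completion (ModPre x)) (η : Completion (ModPre x)) =
      ModPre.form x ζ η :=
  ((Completion.isDenseInducing_toCompl (ModPre x)).prodMap
    (Completion.isDenseInducing_toCompl (ModPre x))).extend_eq (ModPre.continuous_form x) (ζ, η)

lemma ModTensor.induction {p : ModTensor x → Prop} (ζ : ModTensor x) (hc : IsClosed {ζ | p ζ})
    (h0 : p 0) (h1 : ∀ w, p (ModTensor.tprod x w)) (ha : ∀ ζ η, p ζ → p η → p (ζ + η))
    (hs : ∀ (c : ℂ) ζ, p ζ → p (c • ζ)) : p ζ := by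
  refine Completion.induction_on (p := p) ζ hc fun f ↦ ?_
  refine ModPre.induction (p := fun f ↦ p (f : Completion (ModPre x))) f h0 h1 ?_ ?_
  · intro f g hf hg
    rw [Completion.coe_add]; exact ha _ _ hf hg
  · intro c f hf
    rw [Completion.coe_smul]; exact hs _ _ hf

lemma ModTensor.continuous_inner' {T : Type*} [TopologicalSpace T] {f g : T → ModTensor x}
    (hf : Continuous f) (hg : Continuous g) : Continuous fun t ↦ ModTensor.inner (f t) (g t) :=
  ModTensor.continuous_inner.comp (hf.prodMk hg)

lemma ModTensor.inner_add_right (ζ η θ : ModTensor x) :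
    ModTensor.inner ζ (η + θ) = ModTensor.inner ζ η + ModTensor.inner ζ θ :=
  Completion.induction_on₃
    (p := fun ζ η θ : ModTensor x ↦
      ModTensor.inner ζ (η + θ) = ModTensor.inner ζ η + ModTensor.inner ζ θ) ζ η θ
    (isClosed_eq
      (ModTensor.continuous_inner' continuous_fst
        ((continuous_fst.comp continuous_snd).add (continuous_snd.comp continuous_snd)))
      ((ModTensor.continuous_inner' continuous_fst (continuous_fst.comp continuous_snd)).add
        (ModTensor.continuous_inner' continuous_fst (continuous_snd.comp continuous_snd))))
    fun ζ η θ ↦ by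
      rw [ModTensor.inner_coe, ModTensor.inner_coe, ← ModPre.form_add_right, ← ModTensor.inner_coe]
      exact congrArg _ (Completion.coe_add η θ).symm

lemma ModTensor.inner_smul_right (c : ℂ) (ζ η : ModTensor x) :
    ModTensor.inner ζ (c • η) = c • ModTensor.inner ζ η :=
  Completion.induction_on₂
    (p := fun ζ η : ModTensor x ↦ ModTensor.inner ζ (c • η) = c • ModTensor.inner ζ η) ζ η
    (isClosed_eq
      (ModTensor.continuous_inner' continuous_fst (continuous_snd.const_smul c))
      ((ModTensor.continuous_inner' continuous_fst continuous_snd).const_smul c))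
    fun ζ η ↦ by
      rw [ModTensor.inner_coe, ← ModPre.form_smul_right, ← ModTensor.inner_coe]
      exact congrArg _ (Completion.coe_smul c η).symm

lemma ModTensor.star_inner (ζ η : ModTensor x) :
    star (ModTensor.inner ζ η) = ModTensor.inner η ζ :=
  Completion.induction_on₂
    (p := fun ζ η : ModTensor x ↦ star (ModTensor.inner ζ η) = ModTensor.inner η ζ) ζ η
    (isClosed_eq
      (ModTensor.continuous_inner' continuous_fst continuous_snd).star
      (ModTensor.continuous_inner' continuous_snd continuous_fst))
    fun ζ η ↦ by
      rw [ModTensor.inner_coe, ModTensor.inner_coe, ModPre.star_form]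

lemma ModTensor.inner_self_nonneg (ζ : ModTensor x) :
    ∃ b, ModTensor.inner ζ ζ = star b * b := by
  let _ : PartialOrder (AlgTensor P) := CStarAlgebra.spectralOrder _
  have _ : StarOrderedRing (AlgTensor P) := CStarAlgebra.spectralOrderedRing _
  refine exists_star_mul_self ?_
  exact Completion.induction_on (p := fun ζ : ModTensor x ↦ 0 ≤ ModTensor.inner ζ ζ) ζ
    (CStarAlgebra.isClosed_nonneg.preimage (ModTensor.continuous_inner' continuous_id continuous_id))
    fun ζ ↦ by
      rw [ModTensor.inner_coe]; exact ModPre.form_self_nonneg ζ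

lemma ModTensor.norm_sq_eq (ζ : ModTensor x) : ‖ζ‖ ^ 2 = ‖ModTensor.inner ζ ζ‖ :=
  Completion.induction_on (p := fun ζ : ModTensor x ↦ ‖ζ‖ ^ 2 = ‖ModTensor.inner ζ ζ‖) ζ
    (isClosed_eq (by fun_prop) (ModTensor.continuous_inner' continuous_id continuous_id).norm)
    fun ζ ↦ by
      rw [ModTensor.inner_coe, ← ModPre.norm_sq_eq]
      exact congrArg (· ^ 2) (Completion.norm_coe ζ)

lemma ModTensor.norm_inner_le (ζ η : ModTensor x) : ‖ModTensor.inner ζ η‖ ≤ ‖ζ‖ * ‖η‖ :=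
  Completion.induction_on₂ (p := fun ζ η : ModTensor x ↦ ‖ModTensor.inner ζ η‖ ≤ ‖ζ‖ * ‖η‖) ζ η
    (isClosed_le (ModTensor.continuous_inner' continuous_fst continuous_snd).norm
      (continuous_fst.norm.mul continuous_snd.norm))
    fun ζ η ↦ by
      rw [ModTensor.inner_coe]
      refine (ModPre.norm_form_le ζ η).trans_eq ?_
      exact congrArg₂ (· * ·) (Completion.norm_coe ζ).symm (Completion.norm_coe η).symm

lemma ModTensor.inner_tprod (w z : RestrictedFamily X x.vec) :
    ModTensor.inner (ModTensor.tprod x w) (ModTensor.tprod x z) =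
      AlgTensor.tprod P (x.inner w z) :=
  (ModTensor.inner_coe _ _).trans (ModPre.form_single w z)

lemma ModTensor.inner_sub_right (ζ η θ : ModTensor x) :
    ModTensor.inner ζ (η - θ) = ModTensor.inner ζ η - ModTensor.inner ζ θ := by
  rw [sub_eq_add_neg, ← neg_one_smul ℂ θ, ModTensor.inner_add_right, ModTensor.inner_smul_right]
  simp [sub_eq_add_neg]

lemma ModTensor.inner_add_left (ζ η θ : ModTensor x) :
    ModTensor.inner (ζ + η) θ = ModTensor.inner ζ θ + ModTensor.inner η θ := by
  rw [← ModTensor.star_inner, ModTensor.inner_add_right, star_add, ModTensor.star_inner,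
    ModTensor.star_inner]

lemma ModTensor.inner_smul_left (c : ℂ) (ζ η : ModTensor x) :
    ModTensor.inner (c • ζ) η = star c • ModTensor.inner ζ η := by
  rw [← ModTensor.star_inner, ModTensor.inner_smul_right, star_smul, ModTensor.star_inner]

lemma ModTensor.inner_zero_right (ζ : ModTensor x) : ModTensor.inner ζ 0 = 0 := by
  simpa using ModTensor.inner_smul_right 0 ζ 0

lemma isClosed_fst_image {E F : Type*} [NormedAddCommGroup E] [NormedAddCommGroup F]
    [CompleteSpace F] (Γ : Set (E × F)) (hΓ : IsClosed Γ) (C : ℝ)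
    (h : ∀ p ∈ Γ, ∀ q ∈ Γ, dist p.2 q.2 ≤ C * dist p.1 q.1) : IsClosed {e | ∃ z, (e, z) ∈ Γ} := by
  rw [← isSeqClosed_iff_isClosed]
  intro e a he ha
  choose z hz using he
  have hC : ∀ m n, dist (z m) (z n) ≤ |C| * dist (e m) (e n) := fun m n ↦
    (h _ (hz m) _ (hz n)).trans (by gcongr; exact le_abs_self C)
  have hcau : CauchySeq z := by
    have h1 := ha.cauchySeq
    rw [Metric.cauchySeq_iff] at h1 ⊢
    intro ε hε
    obtain ⟨N, hN⟩ := h1 (ε / (|C| + 1)) (by positivity)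
    refine ⟨N, fun m hm n hn ↦ (hC m n).trans_lt ?_⟩
    have h2 := hN m hm n hn
    rw [lt_div_iff₀ (by positivity)] at h2
    nlinarith [abs_nonneg C, dist_nonneg (x := e m) (y := e n)]
  obtain ⟨b, hb⟩ := cauchySeq_tendsto_of_complete hcau
  exact ⟨b, hΓ.mem_of_tendsto (ha.prodMk_nhds hb) (Eventually.of_forall hz)⟩

lemma ModTensor.norm_le_of_inner {z : ModTensor x} {C : ℝ} (hC : 0 ≤ C)
    (h : ‖ModTensor.inner z z‖ ≤ ‖z‖ * C) : ‖z‖ ≤ C := by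
  rw [← ModTensor.norm_sq_eq] at h
  rcases (norm_nonneg z).eq_or_lt with h0 | h0
  · rw [← h0]; exact hC
  · rw [sq] at h; exact le_of_mul_le_mul_left h h0

lemma ModTensor.exists_rsmul_tprod (ζ : ModTensor x) (a : RestrictedFamily A P.proj) :
    ∃ z : ModTensor x, ∀ y,
      ModTensor.inner y z = ModTensor.inner y ζ * AlgTensor.tprod P a := by
  set α := AlgTensor.tprod P a
  refine ModTensor.induction (p := fun ζ ↦ ∃ z : ModTensor x, ∀ y,
      ModTensor.inner y z = ModTensor.inner y ζ * α) ζ ?_ ⟨0, fun y ↦ ?_⟩ ?_ ?_ ?_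
  · refine isClosed_fst_image {p : ModTensor x × ModTensor x | ∀ y,
      ModTensor.inner y p.2 = ModTensor.inner y p.1 * α} ?_ ‖α‖ ?_
    · simp only [Set.ofPred_forall]
      exact isClosed_iInter fun y ↦ isClosed_eq
        (ModTensor.continuous_inner' continuous_const continuous_snd)
        ((ModTensor.continuous_inner' continuous_const continuous_fst).mul continuous_const)
    · intro p hp q hq
      rw [dist_eq_norm, dist_eq_norm]
      refine ModTensor.norm_le_of_inner (by positivity) ?_
      have : ∀ y, ModTensor.inner y (p.2 - q.2) = ModTensor.inner y (p.1 - q.1) * α := fun y ↦ by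
        rw [ModTensor.inner_sub_right, ModTensor.inner_sub_right, sub_mul, hp, hq]
      rw [this]
      calc _ ≤ ‖ModTensor.inner (p.2 - q.2) (p.1 - q.1)‖ * ‖α‖ := norm_mul_le _ _
        _ ≤ ‖p.2 - q.2‖ * ‖p.1 - q.1‖ * ‖α‖ := by gcongr; exact ModTensor.norm_inner_le _ _
        _ = _ := by ring
  · rw [ModTensor.inner_zero_right, zero_mul]
  · intro w
    refine ⟨ModTensor.tprod x (x.rsmul w a), fun y ↦ ?_⟩
    refine ModTensor.induction (p := fun y ↦ ModTensor.inner y (ModTensor.tprod x (x.rsmul w a)) =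
      ModTensor.inner y (ModTensor.tprod x w) * α) y ?_ ?_ ?_ ?_ ?_
    · exact isClosed_eq (ModTensor.continuous_inner' continuous_id continuous_const)
        ((ModTensor.continuous_inner' continuous_id continuous_const).mul continuous_const)
    · rw [← ModTensor.star_inner, ModTensor.inner_zero_right, ← ModTensor.star_inner,
        ModTensor.inner_zero_right]
      simp
    · intro u
      rw [ModTensor.inner_tprod, ModTensor.inner_tprod, ← AlgTensor.tprod_mul,
        CompatibleVectors.inner_rsmul]
    · intro ζ η h1 h2
      rw [ModTensor.inner_add_left, ModTensor.inner_add_left, h1, h2, add_mul]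
    · intro c ζ h1
      rw [ModTensor.inner_smul_left, ModTensor.inner_smul_left, h1, smul_mul_assoc]
  · rintro ζ η ⟨z, hz⟩ ⟨u, hu⟩
    exact ⟨z + u, fun y ↦ by
      rw [ModTensor.inner_add_right, ModTensor.inner_add_right, hz, hu, add_mul]⟩
  · rintro c ζ ⟨z, hz⟩
    exact ⟨c • z, fun y ↦ by
      rw [ModTensor.inner_smul_right, ModTensor.inner_smul_right, hz, smul_mul_assoc]⟩

lemma ModTensor.exists_rsmul (ζ : ModTensor x) (a : AlgTensor P) :
    ∃ z : ModTensor x, ∀ y, ModTensor.inner y z = ModTensor.inner y ζ * a := by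
  refine AlgTensor.induction (p := fun a ↦ ∃ z : ModTensor x, ∀ y,
      ModTensor.inner y z = ModTensor.inner y ζ * a) a ?_ ⟨0, fun y ↦ ?_⟩
      (fun a ↦ ModTensor.exists_rsmul_tprod ζ a) ?_ ?_
  · refine isClosed_fst_image {p : AlgTensor P × ModTensor x | ∀ y,
      ModTensor.inner y p.2 = ModTensor.inner y ζ * p.1} ?_ ‖ζ‖ ?_
    · simp only [Set.ofPred_forall]
      exact isClosed_iInter fun y ↦ isClosed_eq
        (ModTensor.continuous_inner' continuous_const continuous_snd)
        (continuous_const.mul continuous_fst)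
    · intro p hp q hq
      rw [dist_eq_norm, dist_eq_norm]
      refine ModTensor.norm_le_of_inner (by positivity) ?_
      have : ∀ y, ModTensor.inner y (p.2 - q.2) = ModTensor.inner y ζ * (p.1 - q.1) := fun y ↦ by
        rw [ModTensor.inner_sub_right, mul_sub, hp, hq]
      rw [this]
      calc _ ≤ ‖ModTensor.inner (p.2 - q.2) ζ‖ * ‖p.1 - q.1‖ := norm_mul_le _ _
        _ ≤ ‖p.2 - q.2‖ * ‖ζ‖ * ‖p.1 - q.1‖ := by gcongr; exact ModTensor.norm_inner_le _ _
        _ = _ := by ring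
  · rw [ModTensor.inner_zero_right, mul_zero]
  · rintro a b ⟨z, hz⟩ ⟨u, hu⟩
    exact ⟨z + u, fun y ↦ by rw [ModTensor.inner_add_right, hz, hu, mul_add]⟩
  · rintro c a ⟨z, hz⟩
    exact ⟨c • z, fun y ↦ by rw [ModTensor.inner_smul_right, hz, mul_smul_comm]⟩

/-- The restricted tensor product `⊗' (X_v, x_v)` is a Hilbert module over `⊗' (A_v, p_v)`; the
right action is the one determined by `⟨y, ζ a⟩ = ⟨y, ζ⟩ a`, so
`(⊗ w_v) (⊗ a_v) = ⊗ (w_v a_v)`. -/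
instance : RightHilbertModule (AlgTensor P) (ModTensor x) where
  hinner := ModTensor.inner
  rsmul ζ a := (ModTensor.exists_rsmul ζ a).choose
  hinner_add_right := ModTensor.inner_add_right
  hinner_smul_right := ModTensor.inner_smul_right
  hinner_rsmul_right y ζ a := (ModTensor.exists_rsmul ζ a).choose_spec y
  star_hinner := ModTensor.star_inner
  hinner_self_nonneg := ModTensor.inner_self_nonneg
  norm_sq_eq := ModTensor.norm_sq_eq

lemma ModTensor.hinner_tprod (w z : RestrictedFamily X x.vec) :
    hinner (AlgTensor P) (ModTensor.tprod x w) (ModTensor.tprod x z) =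
      AlgTensor.tprod P (x.inner w z) :=
  ModTensor.inner_tprod w z

lemma ModTensor.rsmul_tprod (w : RestrictedFamily X x.vec) (a : RestrictedFamily A P.proj) :
    rsmul (ModTensor.tprod x w) (AlgTensor.tprod P a) = ModTensor.tprod x (x.rsmul w a) := by
  refine ext_hinner (AlgTensor P) fun y ↦ ?_
  rw [hinner_rsmul_right]
  refine ModTensor.induction (p := fun y ↦
    hinner (AlgTensor P) y (ModTensor.tprod x w) * AlgTensor.tprod P a =
      hinner (AlgTensor P) y (ModTensor.tprod x (x.rsmul w a))) y ?_ ?_ ?_ ?_ ?_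
  · exact isClosed_eq
      ((ModTensor.continuous_inner' continuous_id continuous_const).mul continuous_const)
      (ModTensor.continuous_inner' continuous_id continuous_const)
  · rw [hinner_zero_left, hinner_zero_left, zero_mul]
  · intro u
    rw [ModTensor.hinner_tprod, ModTensor.hinner_tprod, ← AlgTensor.tprod_mul,
      CompatibleVectors.inner_rsmul]
  · intro ζ η h1 h2
    rw [hinner_add_left, hinner_add_left, ← h1, ← h2, add_mul]
  · intro c ζ h1
    rw [hinner_smul_left, hinner_smul_left, ← h1, smul_mul_assoc]

variable {A' : I → Type u} [∀ v, NonUnitalCStarAlgebra (A' v)] {P' : ProjectionFamily A'}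

/-- The family `(α_v(a'_v) w_v)`, where `α_v(p'_v) x_v = x_v` at almost all places. -/
def CompatibleVectors.act (x : CompatibleVectors X P)
    (α : ∀ v, A' v →⋆ₙₐ[ℂ] Adjointable (A v) (X v))
    (hα : ∀ᶠ v in cofinite, α v (P'.proj v) (x.vec v) = x.vec v)
    (a' : RestrictedFamily A' P'.proj) (w : RestrictedFamily X x.vec) :
    RestrictedFamily X x.vec :=
  RestrictedFamily.map₂ (fun v a ξ ↦ α v a ξ) hα a' w

/-- The induced factorizable representation of `⊗' (A'_v, p'_v)`: at the place `v`, the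
representation of `A'_v` on `X_v ⊗_{A_v} H_v`, with the distinguished vector `x_v ⊗ h_v`. -/
def FactorRep.induced (R : FactorRep P) (x : CompatibleVectors X P)
    (α : ∀ v, A' v →⋆ₙₐ[ℂ] Adjointable (A v) (X v))
    (hα : ∀ᶠ v in cofinite, α v (P'.proj v) (x.vec v) = x.vec v) : FactorRep P' where
  space v := InteriorTensor (X v) (R.rep v)
  rep v := inducedRep (α v) (R.rep v)
  vec := R.indVec x
  rep_proj := hα.mono fun v h ↦
    (inducedRep_tmul (α v) (P'.proj v) (x.vec v) (R.vec.vec v)).trans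
      (congrArg (fun ξ ↦ InteriorTensor.tmul (R.rep v) ξ (R.vec.vec v)) h)

end Modules

end RTensor
end

open RTensor Filter
universe u w z

noncomputable section

namespace RTensor

open Filter UniformSpace
open scoped InnerProductSpace ComplexOrder

/-! ### Multilinearity of simple tensors -/

section Update

variable {I : Type w} {H : I → Type u} [∀ v, NormedAddCommGroup (H v)]
  [∀ v, InnerProductSpace ℂ (H v)] {h : UnitFamily H}

/-! Everything is read off in factorizable representations. For such a representation `R` of `A`, on
`H_R = ⊗' (H_v, h_v)`, put `K_R = ⊗' (X_v ⊗ H_v, x_v ⊗ h_v)`. A simple tensor `⊗ w_v` of `X` gives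
the creation operator `⊗ y_v ↦ ⊗ (w_v ⊗ y_v)` from `H_R` to `K_R`, and by continuity every `ζ` in
`X` gives an operator `R.create x ζ`. The central identity (`FactorRep.tensorRep_hinner`) is
`π_R(⟨ζ, η⟩) = create(ζ)* create(η)`. Since the norm of `A` is the supremum over all `R`, it follows
that `‖ζ‖ = sup_R ‖create(ζ)‖`: the module `X` sits isometrically in the product of the spaces of
operators `H_R → K_R`, and identities in `X` can be checked there.

For (1), the representations `α_v ⊗ 1` on `X_v ⊗ H_v`, with the vectors `x_v ⊗ h_v`, form a
factorizable representation of `A'` on `K_R`. Hence each `a` in `A'` acts on `K_R` by an operator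
`ρ_R(a)` of norm at most `‖a‖`, and the action of `a` on `X` has to be left multiplication of
creation operators by `ρ_R(a)`. What needs proof is that this multiplication preserves the image of
`X`. It does so for simple tensors of `A'` and of `X` (`FactorRep.inducedTensorRep_comp_creation`).
The relation "`create(η) = ρ_R(a) create(ζ)` for all `R`" is closed, linear in `ζ` and in `a`, and
satisfies `‖η‖ ≤ ‖a‖ ‖ζ‖`; since `X` is complete, the solvable `ζ`, and then the solvable `a`, form
closed subspaces, so all are solvable (`ModTensor.exists_isAct`). The algebraic laws and
adjointability are inherited from those of `ρ_R`. For uniqueness, a `*`-homomorphism into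
`End*_A(X)` is composed with `T ↦ T ⊗ 1` on `X ⊗_A H_R`; the composite is contractive, hence
determined by simple tensors, and these representations together separate the elements of
`End*_A(X)` (`ModTensor.starAlgHom_ext`).

For (2), the unitary is `ζ ⊗ ξ ↦ create(ζ) ξ`. The central identity says exactly that it preserves
inner products. Its range is closed and contains all `⊗ (w_v ⊗ y_v)`, and these are total in `K_R`,
because a simple tensor is linear and continuous in each entry and elementary tensors are total at
each place (`HilbertTensor.tprod_mem_of_total`). The intertwining property is the relation defining
the action, applied to a vector. -/

open scoped Classical in
/-- Replace the entry of a restricted family at one place. -/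
def RestrictedFamily.update {W : I → Type u} {x : ∀ v, W v} (e : RestrictedFamily W x) (v : I)
    (a : W v) : RestrictedFamily W x :=
  ⟨Function.update e.1 v a, by
    filter_upwards [e.2, (Set.finite_singleton v).compl_mem_cofinite] with u h1 h2
    rw [Function.update_of_ne h2, h1]⟩

lemma RestrictedFamily.update_same {W : I → Type u} {x : ∀ v, W v} (e : RestrictedFamily W x)
    (v : I) (a : W v) : e.update v a v = a := by
  simp [RestrictedFamily.update]

lemma RestrictedFamily.update_of_ne {W : I → Type u} {x : ∀ v, W v} (e : RestrictedFamily W x)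
    {u v : I} (a : W v) (huv : u ≠ v) : e.update v a u = e u := by
  simp [RestrictedFamily.update, huv]

lemma RestrictedFamily.update_eq_self {W : I → Type u} {x : ∀ v, W v} (e : RestrictedFamily W x)
    (v : I) : e.update v (e v) = e :=
  Subtype.ext (by simp [RestrictedFamily.update])

open scoped Classical in
-- Only the factor at `v` involves `a` and `b`; the product of the others, with the factor at `v`
-- reset to `1`, is a constant. Linearity and continuity of a simple tensor in a single entry both
-- come from this formula.
lemma HilbertTensor.inner_tprod_update (e f : RestrictedFamily H h.vec) (v : I) (a b : H v) :
    ⟪tprod h (e.update v a), tprod h (f.update v b)⟫_ℂ =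
      ⟪a, b⟫_ℂ * ∏ᶠ u, Function.update (fun u ↦ ⟪e u, f u⟫_ℂ) v 1 u := by
  rw [HilbertTensor.inner_tprod]
  have hfin := eventually_cofinite.mp (tensorKernel_eventually h e f)
  have hsplit : ∀ u, ⟪e.update v a u, f.update v b u⟫_ℂ =
      Function.update (fun _ : I ↦ (1 : ℂ)) v ⟪a, b⟫_ℂ u *
        Function.update (fun u ↦ ⟪e u, f u⟫_ℂ) v 1 u := by
    intro u
    rcases eq_or_ne u v with rfl | huv
    · simp [RestrictedFamily.update_same]
    · simp [RestrictedFamily.update_of_ne _ _ huv, Function.update_of_ne huv]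
  -- Splitting the product requires both families to be `1` at almost all places: the first is so
  -- away from `v`, the second wherever `⟪e u, f u⟫ = 1`.
  rw [finprod_congr hsplit, finprod_mul_distrib, finprod_eq_single _ v, Function.update_self]
  · intro u huv
    rw [Function.update_of_ne huv]
  · refine (Set.finite_singleton v).subset fun u hu ↦ ?_
    by_contra huv
    exact hu (Function.update_of_ne huv _ _)
  · refine hfin.subset fun u hu hu1 ↦ hu ?_
    rcases eq_or_ne u v with rfl | huv
    · exact Function.update_self ..
    · rw [Function.update_of_ne huv]; exact hu1

/-- A simple tensor as a linear function of its entry at one place. -/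
def HilbertTensor.tprodUpdate (h : UnitFamily H) (e : RestrictedFamily H h.vec) (v : I) :
    H v →ₗ[ℂ] HilbertTensor h where
  toFun a := tprod h (e.update v a)
  map_add' a b := KernelSpace.ext_inner fun f ↦ by
    change ⟪tprod h f, _⟫_ℂ = ⟪tprod h f, _⟫_ℂ
    -- Regarding `f` as its own update at `v` makes the product formula applicable; the constant is
    -- the same in every term.
    rw [← f.update_eq_self v, inner_add_right, inner_tprod_update, inner_tprod_update,
      inner_tprod_update, inner_add_right, add_mul]
  map_smul' c a := KernelSpace.ext_inner fun f ↦ by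
    change ⟪tprod h f, _⟫_ℂ = ⟪tprod h f, _⟫_ℂ
    rw [← f.update_eq_self v, RingHom.id_apply, inner_smul_right, inner_tprod_update,
      inner_tprod_update, inner_smul_right, mul_assoc]

lemma HilbertTensor.tprodUpdate_apply (e : RestrictedFamily H h.vec) (v : I) (a : H v) :
    tprodUpdate h e v a = tprod h (e.update v a) := rfl

/-- With `c` the product of `⟪e u, e u⟫` over the places `u ≠ v`, the squared norm of the tensor
with entry `a` at `v` is at most `‖c‖ ‖a‖ ^ 2`, whence the bound `√‖c‖`. -/
lemma HilbertTensor.continuous_tprodUpdate (e : RestrictedFamily H h.vec) (v : I) :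
    Continuous (tprodUpdate h e v) := by
  classical
  set c := ∏ᶠ u, Function.update (fun u ↦ ⟪e u, e u⟫_ℂ) v 1 u
  refine AddMonoidHomClass.continuous_of_bound (tprodUpdate h e v) √‖c‖ fun a ↦ ?_
  rw [← sq_le_sq₀ (norm_nonneg _) (by positivity), mul_pow, Real.sq_sqrt (norm_nonneg _),
    ← inner_self_eq_norm_sq (𝕜 := ℂ), tprodUpdate_apply, inner_tprod_update]
  refine (RCLike.re_le_norm _).trans_eq ?_
  rw [norm_mul, norm_inner_eq_norm_sq, mul_comm]
where
  norm_inner_eq_norm_sq {E : Type u} [NormedAddCommGroup E] [InnerProductSpace ℂ E] (a : E) :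
      ‖⟪a, a⟫_ℂ‖ = ‖a‖ ^ 2 := by
    rw [inner_self_eq_norm_sq_to_K]; simp

/-- A closed subspace containing the simple tensors whose entries at almost all places are the
distinguished vectors, and whose other entries lie in total sets, is everything. -/
lemma HilbertTensor.tprod_mem_of_total {S : Submodule ℂ (HilbertTensor h)}
    (hS : IsClosed (S : Set (HilbertTensor h))) (G : ∀ v, Set (H v))
    (hG : ∀ v, (Submodule.span ℂ (G v)).topologicalClosure = ⊤) (hh : ∀ v, h.vec v ∈ G v)
    (hGS : ∀ e : RestrictedFamily H h.vec, (∀ v, e v ∈ G v) → tprod h e ∈ S)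
    (e : RestrictedFamily H h.vec) : tprod h e ∈ S := by
  classical
  -- Induction on a finite set `F` of places at which the entries are unrestricted. Since `h_v` lies
  -- in `G v`, every restricted family is covered by some `F`.
  suffices key : ∀ F : Finset I, ∀ e : RestrictedFamily H h.vec, (∀ v ∉ F, e v ∈ G v) →
      tprod h e ∈ S by
    have hfin := eventually_cofinite.mp e.2
    refine key hfin.toFinset e fun v hv ↦ ?_
    have : e v = h.vec v := by simpa using hv
    rw [this]; exact hh v
  intro F
  induction F using Finset.induction_on with
  | empty => exact fun e he ↦ hGS e fun v ↦ he v (by simp)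
  | insert v F hv ih =>
    intro e he
    -- With the other entries fixed, the entries at `v` that give a tensor in `S` form a closed
    -- subspace. By induction it contains the total set `G v`, so it is everything.
    have hle : Submodule.span ℂ (G v) ≤ S.comap (tprodUpdate h e v) := by
      refine Submodule.span_le.mpr fun a ha ↦ ih _ fun u hu ↦ ?_
      rcases eq_or_ne u v with rfl | huv
      · rw [RestrictedFamily.update_same]; exact ha
      · rw [RestrictedFamily.update_of_ne _ _ huv]
        exact he u (by simp [huv, hu])
    have hcl := Submodule.topologicalClosure_minimal _ hle
      (hS.preimage (continuous_tprodUpdate e v))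
    rw [hG v] at hcl
    have := hcl (Submodule.mem_top (x := e v))
    rwa [Submodule.mem_comap, tprodUpdate_apply, e.update_eq_self] at this

/-! ### Kernel spaces: totality of the generators, and isometries -/

lemma KernelSpace.closure_span_mk {S : Type*} {K : S → S → ℂ} {hK : IsPSDKernel K} :
    (Submodule.span ℂ (Set.range (KernelSpace.mk K hK))).topologicalClosure = ⊤ := by
  refine eq_top_iff.mpr fun f _ ↦ ?_
  set T := (Submodule.span ℂ (Set.range (KernelSpace.mk K hK))).topologicalClosure
  refine KernelSpace.induction (P := fun f ↦ f ∈ T) f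
    (Submodule.isClosed_topologicalClosure _) T.zero_mem (fun s ↦ ?_)
    (fun _ _ ↦ T.add_mem) (fun c _ ↦ T.smul_mem c)
  exact Submodule.le_topologicalClosure _ (Submodule.subset_span ⟨s, rfl⟩)

/-- The isometry out of a kernel space determined by a map with the same Gram kernel. -/
lemma KernelSpace.exists_isometry {S : Type*} {K : S → S → ℂ} {hK : IsPSDKernel K} {E : Type*}
    [NormedAddCommGroup E] [InnerProductSpace ℂ E] [CompleteSpace E] (φ : S → E)
    (hφ : ∀ s t, ⟪φ s, φ t⟫_ℂ = K s t) :
    ∃ V : KernelSpace K hK →ₗᵢ[ℂ] E, ∀ s, V (KernelSpace.mk K hK s) = φ s := by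
  let L : KernelPre K hK →ₗ[ℂ] E := Finsupp.linearCombination ℂ φ
  have hL : ∀ s, L (KernelPre.single K hK s) = φ s := fun s ↦
    (Finsupp.linearCombination_single ℂ (1 : ℂ) s).trans (one_smul _ _)
  have hin : ∀ f g, ⟪L f, L g⟫_ℂ = ⟪f, g⟫_ℂ := by
    intro f g
    refine KernelPre.induction (P := fun f ↦ ⟪L f, L g⟫_ℂ = ⟪f, g⟫_ℂ) f (by simp) ?_ ?_ ?_
    · intro s
      refine KernelPre.induction (P := fun g ↦ ⟪L (KernelPre.single K hK s), L g⟫_ℂ =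
        ⟪KernelPre.single K hK s, g⟫_ℂ) g (by simp) ?_ ?_ ?_
      · intro t; rw [hL, hL, hφ, KernelPre.inner_single]
      · intro y y' h h'; rw [map_add, inner_add_right, h, h', inner_add_right]
      · intro c y h; rw [map_smul, inner_smul_right, h, inner_smul_right]
    · intro y y' h h'; rw [map_add, inner_add_left, h, h', inner_add_left]
    · intro c y h; rw [map_smul, inner_smul_left, h, inner_smul_left]
  -- `L` need not be injective on the free vector space, but it is isometric for the seminorm, so
  -- null vectors are killed and `L` extends to the Hausdorff completion.
  have hnorm : ∀ f, ‖L f‖ = ‖f‖ := fun f ↦ by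
    rw [← sq_eq_sq₀ (norm_nonneg _) (norm_nonneg _), ← inner_self_eq_norm_sq (𝕜 := ℂ),
      ← inner_self_eq_norm_sq (𝕜 := ℂ), hin]
  let L' : KernelPre K hK →L[ℂ] E := L.mkContinuous 1 fun f ↦ by rw [hnorm, one_mul]
  let V : Completion (KernelPre K hK) →L[ℂ] E := L'.extend Completion.toComplL
  have hV : ∀ f : KernelPre K hK, V f = L f := fun f ↦
    ContinuousLinearMap.extend_eq L' (e := Completion.toComplL) Completion.denseRange_coe
      (Completion.isUniformInducing_coe _) f
  refine ⟨⟨V.toLinearMap, fun f ↦ ?_⟩, fun s ↦ (hV _).trans (hL s)⟩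
  refine Completion.induction_on (p := fun f ↦ ‖V f‖ = ‖f‖) f
    (isClosed_eq V.continuous.norm continuous_norm) fun f ↦ ?_
  rw [hV, hnorm, Completion.norm_coe]

end Update

section Correspondence

variable {I : Type w} {A : I → Type u} [∀ v, NonUnitalCStarAlgebra (A v)]
  {X : I → Type u} [∀ v, NormedAddCommGroup (X v)] [∀ v, NormedSpace ℂ (X v)]
  [∀ v, RightHilbertModule (A v) (X v)] {P : ProjectionFamily A}

/-! ### Creation operators of arbitrary elements -/

/-- The creation operators `H → X ⊗_A H` of all elements of `X = ⊗' (X_v, x_v)`, for a factorizable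
representation on `H = ⊗' (H_v, h_v)`, where `X ⊗_A H` is realized as the restricted tensor product
of the `X_v ⊗_{A_v} H_v`. -/
def FactorRep.create (R : FactorRep P) (x : CompatibleVectors X P) :
    ModTensor x →L[ℂ] (HilbertTensor R.vec →L[ℂ] HilbertTensor (R.indVec x)) :=
  ((R.loc x).mkContinuous 1 fun ζ ↦ by
    rw [one_mul]; exact R.norm_loc_le ζ).extend
    (Completion.toComplL : ModPre x →L[ℂ] Completion (ModPre x))

variable {x : CompatibleVectors X P}

lemma FactorRep.create_tprod (R : FactorRep P) (w : RestrictedFamily X x.vec) :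
    R.create x (ModTensor.tprod x w) = R.creation x w :=
  (ContinuousLinearMap.extend_eq _ (e := Completion.toComplL) Completion.denseRange_coe
    (Completion.isUniformInducing_coe _) _).trans (R.loc_single x w)

lemma ModTensor.continuous_hinner {T : Type*} [TopologicalSpace T] {f g : T → ModTensor x}
    (hf : Continuous f) (hg : Continuous g) :
    Continuous fun t ↦ hinner (AlgTensor P) (f t) (g t) :=
  ModTensor.continuous_inner' hf hg

lemma FactorRep.continuous_tensorRep (R : FactorRep P) : Continuous R.tensorRep :=
  AddMonoidHomClass.continuous_of_bound R.tensorRep 1 fun a ↦ by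
    rw [one_mul]; exact NonUnitalStarAlgHom.norm_apply_le R.tensorRep a

/-- For simple tensors this is the adjoint relation between the local creation operators, multiplied
over all places. Both sides are continuous, conjugate-linear in `ζ` and linear in `η`, so it spreads
to the completion, one variable at a time. It turns the `A`-valued inner product into a product of
operators. -/
lemma FactorRep.tensorRep_hinner (R : FactorRep P) (ζ η : ModTensor x) :
    R.tensorRep (hinner (AlgTensor P) ζ η) = (R.create x ζ).adjoint ∘L R.create x η := by
  refine ModTensor.induction (p := fun ζ ↦
    R.tensorRep (hinner (AlgTensor P) ζ η) = (R.create x ζ).adjoint ∘L R.create x η) ζ ?_ ?_ ?_ ?_ ?_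
  · exact isClosed_eq (R.continuous_tensorRep.comp
      (ModTensor.continuous_hinner continuous_id continuous_const))
      ((ContinuousLinearMap.adjoint.continuous.comp (R.create x).continuous).clm_comp
        continuous_const)
  · rw [hinner_zero_left, map_zero, map_zero, map_zero, ContinuousLinearMap.zero_comp]
  · intro w
    refine ModTensor.induction (p := fun η ↦
      R.tensorRep (hinner (AlgTensor P) (ModTensor.tprod x w) η) =
        (R.create x (ModTensor.tprod x w)).adjoint ∘L R.create x η) η ?_ ?_ ?_ ?_ ?_
    · exact isClosed_eq (R.continuous_tensorRep.comp
        (ModTensor.continuous_hinner continuous_const continuous_id))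
        (continuous_const.clm_comp (R.create x).continuous)
    · rw [hinner_zero_right, map_zero, map_zero, ContinuousLinearMap.comp_zero]
    · intro z
      rw [ModTensor.hinner_tprod, R.create_tprod, R.create_tprod, R.adjoint_creation_comp,
        R.tensorRep_tprod]
    · intro η θ h1 h2
      rw [hinner_add_right, map_add, map_add, h1, h2, ContinuousLinearMap.comp_add]
    · intro c η h1
      rw [hinner_smul_right, map_smul, map_smul, h1, ContinuousLinearMap.comp_smul]
  · intro ζ θ h1 h2
    rw [hinner_add_left, map_add, map_add, map_add, h1, h2, ContinuousLinearMap.add_comp]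
  · intro c ζ h1
    rw [hinner_smul_left, map_smul, map_smul, h1, LinearIsometryEquiv.map_smulₛₗ,
      ContinuousLinearMap.smul_comp]
    rfl

/-- The norm of `⟨ζ, ζ⟩` in `A` is controlled by its images in the factorizable representations, and
there it is `‖create(ζ)* create(ζ)‖ = ‖create(ζ)‖ ^ 2`. -/
lemma ModTensor.norm_le_of_create {ζ : ModTensor x} {C : ℝ} (hC : 0 ≤ C)
    (h : ∀ R : FactorRep P, ‖R.create x ζ‖ ≤ C) : ‖ζ‖ ≤ C := by
  rw [← sq_le_sq₀ (norm_nonneg _) hC, norm_sq_eq_norm_hinner (AlgTensor P)]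
  refine AlgTensor.norm_le (by positivity) fun R ↦ ?_
  rw [R.tensorRep_hinner, ContinuousLinearMap.norm_adjoint_comp_self, ← sq]
  exact pow_le_pow_left₀ (norm_nonneg _) (h R) 2

/-- Converse of the preceding bound, by contractivity of the representation. The two together give
`‖ζ‖ = sup_R ‖create(ζ)‖`. -/
lemma FactorRep.norm_create_apply_le (R : FactorRep P) (ζ : ModTensor x) :
    ‖R.create x ζ‖ ≤ ‖ζ‖ := by
  rw [← sq_le_sq₀ (norm_nonneg _) (norm_nonneg _), norm_sq_eq_norm_hinner (AlgTensor P) ζ, sq,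
    ← ContinuousLinearMap.norm_adjoint_comp_self, ← R.tensorRep_hinner]
  exact NonUnitalStarAlgHom.norm_apply_le R.tensorRep _

lemma ModTensor.ext_create {ζ η : ModTensor x}
    (h : ∀ R : FactorRep P, R.create x ζ = R.create x η) : ζ = η := by
  refine sub_eq_zero.mp (norm_le_zero_iff.mp (ModTensor.norm_le_of_create le_rfl fun R ↦ ?_))
  rw [map_sub, h, sub_self, norm_zero]

/-! ### The left action -/

variable {A' : I → Type u} [∀ v, NonUnitalCStarAlgebra (A' v)] {P' : ProjectionFamily A'}

/-- The restricted tensor product of the induced representations of `A'_v` on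
`X_v ⊗_{A_v} H_v`. -/
def FactorRep.inducedTensorRep (R : FactorRep P) (x : CompatibleVectors X P)
    (α : ∀ v, A' v →⋆ₙₐ[ℂ] Adjointable (A v) (X v))
    (hα : ∀ᶠ v in cofinite, α v (P'.proj v) (x.vec v) = x.vec v) :
    AlgTensor P' →⋆ₙₐ[ℂ] (HilbertTensor (R.indVec x) →L[ℂ] HilbertTensor (R.indVec x)) :=
  (R.induced x α hα).tensorRep

variable {α : ∀ v, A' v →⋆ₙₐ[ℂ] Adjointable (A v) (X v)}
  {hα : ∀ᶠ v in cofinite, α v (P'.proj v) (x.vec v) = x.vec v}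

lemma FactorRep.norm_inducedTensorRep_le (R : FactorRep P) (a : AlgTensor P') :
    ‖R.inducedTensorRep x α hα a‖ ≤ ‖a‖ :=
  NonUnitalStarAlgHom.norm_apply_le (R.induced x α hα).tensorRep a

lemma FactorRep.creation_tprod (R : FactorRep P) (w : RestrictedFamily X x.vec)
    (y : RestrictedFamily R.space R.vec.vec) :
    R.creation x w (HilbertTensor.tprod R.vec y) = HilbertTensor.tprod (R.indVec x) (R.pair x w y) :=
  HilbertTensor.map_tprod _ _ y

lemma FactorRep.inducedTensorRep_tprod_pair (R : FactorRep P) (a : RestrictedFamily A' P'.proj)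
    (w : RestrictedFamily X x.vec) (y : RestrictedFamily R.space R.vec.vec) :
    R.inducedTensorRep x α hα (AlgTensor.tprod P' a)
      (HilbertTensor.tprod (R.indVec x) (R.pair x w y)) =
      HilbertTensor.tprod (R.indVec x) (R.pair x (x.act α hα a w) y) := by
  refine ((R.induced x α hα).op_tprod a (R.pair x w y)).trans ?_
  exact congrArg (HilbertTensor.tprod (R.indVec x))
    (Subtype.ext (funext fun v ↦ inducedRep_tmul (α v) (a v) (w v) (y v)))

/-- The prescribed formula for the action on simple tensors, expressed by operators: left
multiplication by the induced representation turns one creation operator into another. This is the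
starting point for the existence of the action. -/
lemma FactorRep.inducedTensorRep_comp_creation (R : FactorRep P)
    (a : RestrictedFamily A' P'.proj) (w : RestrictedFamily X x.vec) :
    R.inducedTensorRep x α hα (AlgTensor.tprod P' a) ∘L R.creation x w =
      R.creation x (x.act α hα a w) := by
  refine KernelSpace.clm_ext fun y ↦ ?_
  change R.inducedTensorRep x α hα (AlgTensor.tprod P' a)
    (R.creation x w (HilbertTensor.tprod R.vec y)) =
      R.creation x (x.act α hα a w) (HilbertTensor.tprod R.vec y)
  rw [R.creation_tprod, R.creation_tprod, R.inducedTensorRep_tprod_pair]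

/-! ### The action as a relation between vectors -/

variable (x α hα) in
/-- `η = a ζ` for the left action of `a ∈ ⊗' (A'_v, p'_v)` on `⊗' (X_v, x_v)`, in terms of creation
operators. -/
def ModTensor.IsAct (a : AlgTensor P') (ζ η : ModTensor x) : Prop :=
  ∀ R : FactorRep P, R.create x η = R.inducedTensorRep x α hα a ∘L R.create x ζ

/-- The bound holds for each `R` because the induced representation is contractive, and it survives
the supremum. Applied to differences, it makes solutions `η` depend Lipschitz-continuously on `ζ`
and on `a`. -/
lemma ModTensor.IsAct.norm_le {a : AlgTensor P'} {ζ η : ModTensor x}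
    (h : ModTensor.IsAct x α hα a ζ η) : ‖η‖ ≤ ‖a‖ * ‖ζ‖ := by
  refine ModTensor.norm_le_of_create (by positivity) fun R ↦ ?_
  rw [h R]
  exact (ContinuousLinearMap.opNorm_comp_le _ _).trans
    (mul_le_mul (R.norm_inducedTensorRep_le a) (R.norm_create_apply_le ζ) (norm_nonneg _)
      (norm_nonneg _))

lemma ModTensor.IsAct.add_right {a : AlgTensor P'} {ζ ζ' η η' : ModTensor x}
    (h : ModTensor.IsAct x α hα a ζ η) (h' : ModTensor.IsAct x α hα a ζ' η') :
    ModTensor.IsAct x α hα a (ζ + ζ') (η + η') := fun R ↦ by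
  rw [map_add, map_add, h R, h' R, ContinuousLinearMap.comp_add]

lemma ModTensor.IsAct.smul_right {a : AlgTensor P'} {ζ η : ModTensor x} (c : ℂ)
    (h : ModTensor.IsAct x α hα a ζ η) : ModTensor.IsAct x α hα a (c • ζ) (c • η) := fun R ↦ by
  rw [map_smul, map_smul, h R, ContinuousLinearMap.comp_smul]

lemma ModTensor.IsAct.add_left {a b : AlgTensor P'} {ζ η η' : ModTensor x}
    (h : ModTensor.IsAct x α hα a ζ η) (h' : ModTensor.IsAct x α hα b ζ η') :
    ModTensor.IsAct x α hα (a + b) ζ (η + η') := fun R ↦ by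
  rw [map_add, map_add, h R, h' R, ContinuousLinearMap.add_comp]

lemma ModTensor.IsAct.smul_left {a : AlgTensor P'} {ζ η : ModTensor x} (c : ℂ)
    (h : ModTensor.IsAct x α hα a ζ η) : ModTensor.IsAct x α hα (c • a) ζ (c • η) := fun R ↦ by
  rw [map_smul, map_smul, h R, ContinuousLinearMap.smul_comp]

lemma ModTensor.IsAct.zero_left (ζ : ModTensor x) : ModTensor.IsAct x α hα 0 ζ 0 := fun R ↦ by
  rw [map_zero, map_zero, ContinuousLinearMap.zero_comp]

lemma ModTensor.IsAct.zero_right (a : AlgTensor P') : ModTensor.IsAct x α hα a 0 0 := fun R ↦ by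
  rw [map_zero, ContinuousLinearMap.comp_zero]

lemma ModTensor.IsAct.mul {a b : AlgTensor P'} {ζ η θ : ModTensor x}
    (h : ModTensor.IsAct x α hα b ζ η) (h' : ModTensor.IsAct x α hα a η θ) :
    ModTensor.IsAct x α hα (a * b) ζ θ := fun R ↦ by
  rw [h' R, h R, map_mul]
  rfl

lemma ModTensor.isAct_tprod (a : RestrictedFamily A' P'.proj) (w : RestrictedFamily X x.vec) :
    ModTensor.IsAct x α hα (AlgTensor.tprod P' a) (ModTensor.tprod x w)
      (ModTensor.tprod x (x.act α hα a w)) := fun R ↦ by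
  rw [R.create_tprod, R.create_tprod, R.inducedTensorRep_comp_creation]

lemma ModTensor.IsAct.unique {a : AlgTensor P'} {ζ η η' : ModTensor x}
    (h : ModTensor.IsAct x α hα a ζ η) (h' : ModTensor.IsAct x α hα a ζ η') : η = η' :=
  ModTensor.ext_create fun R ↦ by rw [h R, h' R]

/-- In every `R` both sides are `create(ζ)* ρ(a)* create(ζ')`, where `ρ` is the induced
representation of `A'`. This is the source of adjointability: `a*` acts as an adjoint of `a`. -/
lemma ModTensor.IsAct.hinner {a : AlgTensor P'} {ζ η ζ' η' : ModTensor x}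
    (h : ModTensor.IsAct x α hα a ζ η) (h' : ModTensor.IsAct x α hα (star a) ζ' η') :
    hinner (AlgTensor P) η ζ' = hinner (AlgTensor P) ζ η' :=
  AlgTensor.ext_rep fun R ↦ by
    rw [R.tensorRep_hinner, R.tensorRep_hinner, h R, h' R, map_star,
      ContinuousLinearMap.star_eq_adjoint, ContinuousLinearMap.adjoint_comp,
      ContinuousLinearMap.comp_assoc]

/-! ### Existence of the action by closed graphs -/

lemma FactorRep.continuous_inducedTensorRep (R : FactorRep P) :
    Continuous (R.inducedTensorRep x α hα) :=
  (R.induced x α hα).continuous_tensorRep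

/-- For each `R` the condition is an equation between jointly continuous functions of `(a, ζ, η)`.
-/
lemma ModTensor.isClosed_isAct : IsClosed {p : AlgTensor P' × ModTensor x × ModTensor x |
    ModTensor.IsAct x α hα p.1 p.2.1 p.2.2} := by
  simp only [ModTensor.IsAct, Set.ofPred_forall]
  refine isClosed_iInter fun R ↦ isClosed_eq
    ((R.create x).continuous.comp (continuous_snd.comp continuous_snd)) ?_
  exact (R.continuous_inducedTensorRep.comp continuous_fst).clm_comp
    ((R.create x).continuous.comp (continuous_fst.comp continuous_snd))

/-- The vectors on which a simple tensor of `A'` acts form a subspace containing the simple tensors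
of `X`. It is closed: along a convergent sequence of such vectors the images are Cauchy by the norm
bound, and the closed relation holds in the limit. -/
lemma ModTensor.exists_isAct_tprod (a : RestrictedFamily A' P'.proj) (ζ : ModTensor x) :
    ∃ η, ModTensor.IsAct x α hα (AlgTensor.tprod P' a) ζ η := by
  refine ModTensor.induction
    (p := fun ζ ↦ ∃ η, ModTensor.IsAct x α hα (AlgTensor.tprod P' a) ζ η) ζ ?_
    ⟨0, ModTensor.IsAct.zero_right _⟩ (fun w ↦ ⟨_, ModTensor.isAct_tprod a w⟩) ?_ ?_
  · refine isClosed_fst_image {p : ModTensor x × ModTensor x |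
      ModTensor.IsAct x α hα (AlgTensor.tprod P' a) p.1 p.2}
      (ModTensor.isClosed_isAct.preimage (continuous_const.prodMk continuous_id))
      ‖AlgTensor.tprod P' a‖ fun p hp q hq ↦ ?_
    rw [dist_eq_norm, dist_eq_norm]
    -- The Lipschitz estimate is the norm bound for the differences, which are again in the
    -- relation.
    refine ModTensor.IsAct.norm_le (α := α) (hα := hα) fun R ↦ ?_
    rw [map_sub, map_sub, hp R, hq R, ContinuousLinearMap.comp_sub]
  · rintro ζ ζ' ⟨η, h⟩ ⟨η', h'⟩
    exact ⟨_, h.add_right h'⟩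
  · rintro c ζ ⟨η, h⟩
    exact ⟨_, h.smul_right c⟩

variable (α hα) in
-- The same closedness argument, now in `a` with `ζ` fixed; the Lipschitz constant becomes `‖ζ‖`.
lemma ModTensor.exists_isAct (a : AlgTensor P') (ζ : ModTensor x) :
    ∃ η, ModTensor.IsAct x α hα a ζ η := by
  refine AlgTensor.induction (p := fun a ↦ ∃ η, ModTensor.IsAct x α hα a ζ η) a ?_
    ⟨0, ModTensor.IsAct.zero_left _⟩ (fun a ↦ ModTensor.exists_isAct_tprod a ζ) ?_ ?_
  · refine isClosed_fst_image {p : AlgTensor P' × ModTensor x | ModTensor.IsAct x α hα p.1 ζ p.2}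
      (ModTensor.isClosed_isAct.preimage
        (continuous_fst.prodMk (continuous_const.prodMk continuous_snd))) ‖ζ‖ fun p hp q hq ↦ ?_
    rw [dist_eq_norm, dist_eq_norm, mul_comm]
    refine ModTensor.IsAct.norm_le (α := α) (hα := hα) fun R ↦ ?_
    rw [map_sub, map_sub, hp R, hq R, ContinuousLinearMap.sub_comp]
  · rintro a b ⟨η, h⟩ ⟨η', h'⟩
    exact ⟨_, h.add_left h'⟩
  · rintro c a ⟨η, h⟩
    exact ⟨_, h.smul_left c⟩

/-! ### The action as a `*`-homomorphism -/

variable (x α hα) in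
/-- The bounded operator by which `a ∈ ⊗' (A'_v, p'_v)` acts on `⊗' (X_v, x_v)`. -/
def ModTensor.actCLM (a : AlgTensor P') : ModTensor x →L[ℂ] ModTensor x :=
  LinearMap.mkContinuous
    -- The choice is harmless, since `η` is unique: each law below follows by exhibiting a second
    -- solution of the same relation.
    { toFun := fun ζ ↦ (ModTensor.exists_isAct α hα a ζ).choose
      map_add' := fun ζ ζ' ↦ (ModTensor.exists_isAct α hα a _).choose_spec.unique
        ((ModTensor.exists_isAct α hα a ζ).choose_spec.add_right
          (ModTensor.exists_isAct α hα a ζ').choose_spec)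
      map_smul' := fun c ζ ↦ (ModTensor.exists_isAct α hα a _).choose_spec.unique
        ((ModTensor.exists_isAct α hα a ζ).choose_spec.smul_right c) } ‖a‖
    fun ζ ↦ (ModTensor.exists_isAct α hα a ζ).choose_spec.norm_le

lemma ModTensor.isAct_actCLM (a : AlgTensor P') (ζ : ModTensor x) :
    ModTensor.IsAct x α hα a ζ (ModTensor.actCLM x α hα a ζ) :=
  (ModTensor.exists_isAct α hα a ζ).choose_spec

variable (x α hα) in
/-- The adjointable operator by which `a ∈ ⊗' (A'_v, p'_v)` acts on `⊗' (X_v, x_v)`. -/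
def ModTensor.actAdjointable (a : AlgTensor P') : Adjointable (AlgTensor P) (ModTensor x) :=
  ⟨ModTensor.actCLM x α hα a, ModTensor.actCLM x α hα (star a), fun ζ η ↦
    (ModTensor.isAct_actCLM a ζ).hinner (ModTensor.isAct_actCLM (star a) η)⟩

lemma ModTensor.isAct_actAdjointable (a : AlgTensor P') (ζ : ModTensor x) :
    ModTensor.IsAct x α hα a ζ (ModTensor.actAdjointable x α hα a ζ) :=
  ModTensor.isAct_actCLM a ζ

variable (x α hα) in
/-- The left action of `⊗' (A'_v, p'_v)` on `⊗' (X_v, x_v)`. -/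
def ModTensor.actHom : AlgTensor P' →⋆ₙₐ[ℂ] Adjointable (AlgTensor P) (ModTensor x) where
  toFun := ModTensor.actAdjointable x α hα
  map_smul' c a := Adjointable.ext fun ζ ↦ (ModTensor.isAct_actAdjointable _ ζ).unique
    ((ModTensor.isAct_actAdjointable a ζ).smul_left c)
  map_zero' := Adjointable.ext fun ζ ↦ (ModTensor.isAct_actAdjointable _ ζ).unique
    (ModTensor.IsAct.zero_left ζ)
  map_add' a b := Adjointable.ext fun ζ ↦ (ModTensor.isAct_actAdjointable _ ζ).unique
    ((ModTensor.isAct_actAdjointable a ζ).add_left (ModTensor.isAct_actAdjointable b ζ))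
  map_mul' a b := Adjointable.ext fun ζ ↦ (ModTensor.isAct_actAdjointable _ ζ).unique
    ((ModTensor.isAct_actAdjointable b ζ).mul (ModTensor.isAct_actAdjointable a _))
  -- The star on `End*_A(X)` is a chosen adjoint, accessible only through inner products, so both
  -- sides are tested against an arbitrary `η`.
  map_star' a := Adjointable.ext fun ζ ↦ ext_hinner (AlgTensor P) fun η ↦ by
    rw [← Adjointable.hinner_apply_left]
    exact ((ModTensor.isAct_actAdjointable a η).hinner
      (ModTensor.isAct_actAdjointable (star a) ζ)).symm

lemma ModTensor.isAct_actHom (a : AlgTensor P') (ζ : ModTensor x) :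
    ModTensor.IsAct x α hα a ζ (ModTensor.actHom x α hα a ζ) :=
  ModTensor.isAct_actCLM a ζ

lemma ModTensor.actHom_tprod (a : RestrictedFamily A' P'.proj) (w : RestrictedFamily X x.vec) :
    ModTensor.actHom x α hα (AlgTensor.tprod P' a) (ModTensor.tprod x w) =
      ModTensor.tprod x (x.act α hα a w) :=
  (ModTensor.isAct_actHom _ _).unique (ModTensor.isAct_tprod a w)

/-! ### Uniqueness of the left action -/

/-- Elements of `⊗' (X_v, x_v)` are separated by their tensors with factorizable
representations. -/
lemma ModTensor.ext_tmul {ζ η : ModTensor x} (h : ∀ (R : FactorRep P) (ξ : HilbertTensor R.vec),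
    InteriorTensor.tmul R.tensorRep ζ ξ = InteriorTensor.tmul R.tensorRep η ξ) : ζ = η := by
  refine ext_hinner (AlgTensor P) fun θ ↦ AlgTensor.ext_rep fun R ↦ ?_
  ext1 ξ
  refine ext_inner_left ℂ fun ξ' ↦ ?_
  -- The matrix coefficients of `⟨θ, ζ⟩` in `R` are the inner products of `θ ⊗ ξ'` with `ζ ⊗ ξ`, so
  -- they depend on `ζ` only through `ζ ⊗ ξ`.
  rw [← InteriorTensor.inner_tmul, ← InteriorTensor.inner_tmul, h]

/-- A `*`-homomorphism from `⊗' (A'_v, p'_v)` to `End*_A(X)`, `X = ⊗' (X_v, x_v)`, is determined by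
the action of simple tensors on simple tensors. -/
lemma ModTensor.starAlgHom_ext {β β' : AlgTensor P' →⋆ₙₐ[ℂ] Adjointable (AlgTensor P) (ModTensor x)}
    (h : ∀ (a : RestrictedFamily A' P'.proj) (w : RestrictedFamily X x.vec),
      β (AlgTensor.tprod P' a) (ModTensor.tprod x w) =
        β' (AlgTensor.tprod P' a) (ModTensor.tprod x w)) : β = β' := by
  -- No continuity of `β` is assumed. Its composite with `T ↦ T ⊗ 1` is a `*`-homomorphism into the
  -- bounded operators on a Hilbert space, hence contractive, and density of the span of simple
  -- tensors can be used there.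
  have hrep : ∀ R : FactorRep P, inducedRep β R.tensorRep = inducedRep β' R.tensorRep := by
    intro R
    have hcont : ∀ γ : AlgTensor P' →⋆ₙₐ[ℂ] Adjointable (AlgTensor P) (ModTensor x),
        Continuous (inducedRep γ R.tensorRep) := fun γ ↦
      AddMonoidHomClass.continuous_of_bound _ 1 fun a ↦ by
        rw [one_mul]; exact NonUnitalStarAlgHom.norm_apply_le (inducedRep γ R.tensorRep) a
    refine DFunLike.ext _ _ fun a ↦ ?_
    refine AlgTensor.induction
      (p := fun a ↦ inducedRep β R.tensorRep a = inducedRep β' R.tensorRep a) a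
      (isClosed_eq (hcont β) (hcont β')) (by rw [map_zero, map_zero]) (fun a ↦ ?_) ?_ ?_
    · refine InteriorTensor.clm_ext fun ζ ξ ↦ ?_
      rw [inducedRep_tmul, inducedRep_tmul]
      congr 1
      -- For a fixed simple tensor of `A'`, both operators on `X` are bounded, so agreement on
      -- simple tensors suffices.
      refine ModTensor.induction (p := fun ζ ↦
        β (AlgTensor.tprod P' a) ζ = β' (AlgTensor.tprod P' a) ζ) ζ
        (isClosed_eq (ContinuousLinearMap.continuous _) (ContinuousLinearMap.continuous _))
        (by simp) (h a) ?_ ?_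
      · intro ζ η h1 h2; rw [map_add, map_add, h1, h2]
      · intro c ζ h1; rw [map_smul, map_smul, h1]
    · intro a b h1 h2; rw [map_add, map_add, h1, h2]
    · intro c a h1; rw [map_smul, map_smul, h1]
  refine DFunLike.ext _ _ fun a ↦ Adjointable.ext fun ζ ↦ ModTensor.ext_tmul fun R ξ ↦ ?_
  rw [← inducedRep_tmul, ← inducedRep_tmul, hrep]

/-! ### The interior tensor product with a factorizable representation -/

variable {H : Type z} [NormedAddCommGroup H] [InnerProductSpace ℂ H] [CompleteSpace H]
  {π : AlgTensor P →⋆ₙₐ[ℂ] (H →L[ℂ] H)}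

lemma FactorRep.total_tmul (R : FactorRep P) (v : I) :
    (Submodule.span ℂ {ξ : InteriorTensor (X v) (R.rep v) | ∃ (ζ : X v) (η : R.space v),
      ξ = InteriorTensor.tmul (R.rep v) ζ η}).topologicalClosure = ⊤ := by
  refine eq_top_iff.mpr (KernelSpace.closure_span_mk.ge.trans
    (Submodule.topologicalClosure_mono (Submodule.span_mono ?_)))
  rintro _ ⟨s, rfl⟩
  exact ⟨s.1, s.2, rfl⟩

/-- Identifies the simple tensors with elementary entries as those of the form `⊗ (w_v ⊗ y_v)`. The
point is that the local factorizations can be chosen to give restricted families. -/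
lemma FactorRep.exists_pair_eq (R : FactorRep P)
    (e : RestrictedFamily (fun v ↦ InteriorTensor (X v) (R.rep v)) (R.indVec x).vec)
    (he : ∀ v, ∃ (ζ : X v) (η : R.space v), e v = InteriorTensor.tmul (R.rep v) ζ η) :
    ∃ w y, R.pair x w y = e := by
  -- An elementary tensor factors in many ways. Wherever `e v` is the distinguished vector, the pair
  -- `(x_v, h_v)` is imposed, so that both chosen families are distinguished at almost all places.
  have : ∀ v, ∃ p : X v × R.space v, e v = InteriorTensor.tmul (R.rep v) p.1 p.2 ∧
      (e v = (R.indVec x).vec v → p = (x.vec v, R.vec.vec v)) := by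
    intro v
    by_cases h : e v = (R.indVec x).vec v
    · exact ⟨(x.vec v, R.vec.vec v), h, fun _ ↦ rfl⟩
    · obtain ⟨ζ, η, hζ⟩ := he v
      exact ⟨(ζ, η), hζ, fun h' ↦ (h h').elim⟩
  choose p hp hp' using this
  refine ⟨⟨fun v ↦ (p v).1, e.2.mono fun v h ↦ congrArg Prod.fst (hp' v h)⟩,
    ⟨fun v ↦ (p v).2, e.2.mono fun v h ↦ congrArg Prod.snd (hp' v h)⟩, ?_⟩
  exact Subtype.ext (funext fun v ↦ (hp v).symm)

/-- The vectors `create(ζ) (Φ ξ)` have the Gram kernel that defines `X ⊗_A H`, by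
`FactorRep.tensorRep_hinner` and the equivariance of `Φ`; this gives an isometry. Its range is
closed, as the isometric image of a complete space, and contains a total set. -/
lemma FactorRep.exists_interiorTensor_equiv (R : FactorRep P) (Φ : H ≃ₗᵢ[ℂ] HilbertTensor R.vec)
    (hΦ : ∀ a ξ, Φ (π a ξ) = R.tensorRep a (Φ ξ)) :
    ∃ U : InteriorTensor (ModTensor x) π ≃ₗᵢ[ℂ] HilbertTensor (R.indVec x),
      ∀ ζ ξ, U (InteriorTensor.tmul π ζ ξ) = R.create x ζ (Φ ξ) := by
  obtain ⟨V, hV⟩ := KernelSpace.exists_isometry (K := interiorKernel (ModTensor x) π)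
    (hK := interiorKernel_psd π) (fun s ↦ R.create x s.1 (Φ s.2)) fun s t ↦ by
      rw [interiorKernel, ← Φ.inner_map_map, hΦ, R.tensorRep_hinner,
        ContinuousLinearMap.comp_apply, ContinuousLinearMap.adjoint_inner_right]
  have hclosed : IsClosed (LinearMap.range V.toLinearMap : Set (HilbertTensor (R.indVec x))) := by
    rw [LinearMap.coe_range]
    exact V.isometry.isClosedEmbedding.isClosed_range
  have hsurj : Function.Surjective V := by
    intro f
    refine KernelSpace.induction (P := fun f ↦ f ∈ LinearMap.range V.toLinearMap) f hclosed
      (zero_mem _) ?_ (fun _ _ ↦ add_mem) (fun c _ ↦ Submodule.smul_mem _ c)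
    -- Elementary tensors are total at each place and include `x_v ⊗ h_v`, so only simple tensors
    -- with elementary entries remain; their preimages are explicit.
    refine HilbertTensor.tprod_mem_of_total hclosed _ R.total_tmul
      (fun v ↦ ⟨x.vec v, R.vec.vec v, rfl⟩) fun e he ↦ ?_
    obtain ⟨w, y, rfl⟩ := R.exists_pair_eq e he
    refine ⟨InteriorTensor.tmul π (ModTensor.tprod x w) (Φ.symm (HilbertTensor.tprod R.vec y)), ?_⟩
    refine (hV _).trans ?_
    rw [Φ.apply_symm_apply, R.create_tprod, R.creation_tprod]
  exact ⟨LinearIsometryEquiv.ofSurjective V hsurj, fun ζ ξ ↦ hV (ζ, ξ)⟩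

lemma InteriorTensor.continuous_tmul_left {B Y : Type*} [NonUnitalCStarAlgebra B]
    [NormedAddCommGroup Y] [NormedSpace ℂ Y] [RightHilbertModule B Y]
    (ρ : B →⋆ₙₐ[ℂ] (H →L[ℂ] H)) (ξ : H) : Continuous fun ζ : Y ↦ InteriorTensor.tmul ρ ζ ξ :=
  (LinearMap.mkContinuous (σ := RingHom.id ℂ)
    { toFun := fun ζ : Y ↦ InteriorTensor.tmul ρ ζ ξ
      map_add' := fun ζ η ↦ InteriorTensor.add_tmul ζ η ξ
      map_smul' := fun c ζ ↦ InteriorTensor.smul_tmul c ζ ξ } ‖ξ‖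
    fun ζ ↦ (InteriorTensor.norm_tmul_le ζ ξ).trans_eq (mul_comm _ _)).continuous

/-- Bounded operators on `X ⊗_A H` are determined by their values on the elementary tensors of
simple tensors. -/
lemma FactorRep.interiorTensor_clm_ext (R : FactorRep P) (Φ : H ≃ₗᵢ[ℂ] HilbertTensor R.vec)
    {E : Type*} [NormedAddCommGroup E] [NormedSpace ℂ E]
    {T T' : InteriorTensor (ModTensor x) π →L[ℂ] E}
    (h : ∀ (w : RestrictedFamily X x.vec) (y : RestrictedFamily R.space R.vec.vec),
      T (InteriorTensor.tmul π (ModTensor.tprod x w) (Φ.symm (HilbertTensor.tprod R.vec y))) =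
        T' (InteriorTensor.tmul π (ModTensor.tprod x w) (Φ.symm (HilbertTensor.tprod R.vec y)))) :
    T = T' := by
  refine InteriorTensor.clm_ext fun ζ ξ ↦ ?_
  refine ModTensor.induction (p := fun ζ ↦ T (InteriorTensor.tmul π ζ ξ) =
    T' (InteriorTensor.tmul π ζ ξ)) ζ ?_ ?_ (fun w ↦ ?_) ?_ ?_
  · exact isClosed_eq (T.continuous.comp (InteriorTensor.continuous_tmul_left π ξ))
      (T'.continuous.comp (InteriorTensor.continuous_tmul_left π ξ))
  · have : InteriorTensor.tmul π (0 : ModTensor x) ξ = 0 := by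
      simpa using InteriorTensor.smul_tmul (π := π) 0 (0 : ModTensor x) ξ
    rw [this, map_zero, map_zero]
  -- For fixed `w`, the map `ξ ↦ T (w ⊗ ξ)` is bounded on `H`; transported by `Φ` to `⊗' (H_v,
  -- h_v)`, it is determined by the simple tensors `⊗ y_v`.
  · have hcomp : (T ∘L InteriorTensor.creation π (ModTensor.tprod x w)) ∘L
        (Φ.symm : HilbertTensor R.vec →L[ℂ] H) =
        (T' ∘L InteriorTensor.creation π (ModTensor.tprod x w)) ∘L
        (Φ.symm : HilbertTensor R.vec →L[ℂ] H) := KernelSpace.clm_ext (h w)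
    have := DFunLike.congr_fun hcomp (Φ ξ)
    simpa [InteriorTensor.creation_apply] using this
  · intro ζ η h1 h2; rw [InteriorTensor.add_tmul, map_add, map_add, h1, h2]
  · intro c ζ h1; rw [InteriorTensor.smul_tmul, map_smul, map_smul, h1]

end Correspondence

end RTensor
end

/-! ### The correspondence and its tensor product with a factorizable representation -/

theorem proposition5 {I : Type w} {A A' X : I → Type u}
    [∀ v, NonUnitalCStarAlgebra (A v)] [∀ v, NonUnitalCStarAlgebra (A' v)]
    [∀ v, NormedAddCommGroup (X v)] [∀ v, NormedSpace ℂ (X v)] [∀ v, CompleteSpace (X v)]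
    [∀ v, RightHilbertModule (A v) (X v)]
    (P : ProjectionFamily A) (P' : ProjectionFamily A') (x : CompatibleVectors X P)
    (α : ∀ v, A' v →⋆ₙₐ[ℂ] Adjointable (A v) (X v))
    (hα : ∀ᶠ v in cofinite, α v (P'.proj v) (x.vec v) = x.vec v) :
    ∃ β : AlgTensor P' →⋆ₙₐ[ℂ] Adjointable (AlgTensor P) (ModTensor x),
      (∀ (a' : RestrictedFamily A' P'.proj) (w : RestrictedFamily X x.vec),
        β (AlgTensor.tprod P' a') (ModTensor.tprod x w) = ModTensor.tprod x (x.act α hα a' w)) ∧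
      (∀ β' : AlgTensor P' →⋆ₙₐ[ℂ] Adjointable (AlgTensor P) (ModTensor x),
        (∀ (a' : RestrictedFamily A' P'.proj) (w : RestrictedFamily X x.vec),
          β' (AlgTensor.tprod P' a') (ModTensor.tprod x w) =
            ModTensor.tprod x (x.act α hα a' w)) → β' = β) ∧
      ∀ (R : FactorRep P) (H : Type z) [NormedAddCommGroup H] [InnerProductSpace ℂ H]
        [CompleteSpace H] (π : AlgTensor P →⋆ₙₐ[ℂ] (H →L[ℂ] H))
        (Φ : H ≃ₗᵢ[ℂ] HilbertTensor R.vec), (∀ a ξ, Φ (π a ξ) = R.tensorRep a (Φ ξ)) →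
        ∃ U : InteriorTensor (ModTensor x) π ≃ₗᵢ[ℂ] HilbertTensor (R.induced x α hα).vec,
          (∀ (w : RestrictedFamily X x.vec) (y : RestrictedFamily R.space R.vec.vec),
            U (InteriorTensor.tmul π (ModTensor.tprod x w) (Φ.symm (HilbertTensor.tprod R.vec y))) =
              HilbertTensor.tprod (R.indVec x) (R.pair x w y)) ∧
          (∀ U' : InteriorTensor (ModTensor x) π ≃ₗᵢ[ℂ] HilbertTensor (R.induced x α hα).vec,
            (∀ (w : RestrictedFamily X x.vec) (y : RestrictedFamily R.space R.vec.vec),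
              U' (InteriorTensor.tmul π (ModTensor.tprod x w)
                (Φ.symm (HilbertTensor.tprod R.vec y))) =
                HilbertTensor.tprod (R.indVec x) (R.pair x w y)) → U' = U) ∧
          ∀ (a' : AlgTensor P') (ζ : InteriorTensor (ModTensor x) π),
            U (inducedRep β π a' ζ) = (R.induced x α hα).tensorRep a' (U ζ) := by
  refine ⟨ModTensor.actHom x α hα, ModTensor.actHom_tprod, fun β' hβ' ↦
    ModTensor.starAlgHom_ext fun a w ↦ by rw [hβ', ModTensor.actHom_tprod], ?_⟩
  intro R H _ _ _ π Φ hΦ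
  -- `hU` describes `U` on `ζ ⊗ ξ` for every `ζ` in `X`, not just for simple tensors. The
  -- intertwining property can therefore be checked for arbitrary `a'` and `ζ`, without another
  -- density argument in `A'`.
  obtain ⟨U, hU⟩ := R.exists_interiorTensor_equiv (x := x) Φ hΦ
  have hUt : ∀ (w : RestrictedFamily X x.vec) (y : RestrictedFamily R.space R.vec.vec),
      U (InteriorTensor.tmul π (ModTensor.tprod x w) (Φ.symm (HilbertTensor.tprod R.vec y))) =
        HilbertTensor.tprod (R.indVec x) (R.pair x w y) := fun w y ↦ by
    rw [hU, Φ.apply_symm_apply, R.create_tprod, R.creation_tprod]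
  refine ⟨U, hUt, fun U' hU' ↦ ?_, fun a' ζ ↦ ?_⟩
  · have hext := R.interiorTensor_clm_ext (x := x) (π := π) Φ
      (T := U'.toContinuousLinearEquiv.toContinuousLinearMap)
      (T' := U.toContinuousLinearEquiv.toContinuousLinearMap)
      fun w y ↦ (hU' w y).trans (hUt w y).symm
    exact LinearIsometryEquiv.ext fun ζ ↦ DFunLike.congr_fun hext ζ
  · have hext : U.toContinuousLinearEquiv.toContinuousLinearMap ∘L
        inducedRep (ModTensor.actHom x α hα) π a' =
        R.inducedTensorRep x α hα a' ∘L U.toContinuousLinearEquiv.toContinuousLinearMap := by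
      refine InteriorTensor.clm_ext fun ζ ξ ↦ ?_
      change U (inducedRep (ModTensor.actHom x α hα) π a' (InteriorTensor.tmul π ζ ξ)) =
        R.inducedTensorRep x α hα a' (U (InteriorTensor.tmul π ζ ξ))
      -- At the given `R`, the defining relation of the action reads `create(a' ζ) = ρ(a')
      -- create(ζ)`, with `ρ` the induced representation; evaluated at `Φ ξ`, this is the claim.
      rw [inducedRep_tmul, hU, hU, ModTensor.isAct_actHom a' ζ R, ContinuousLinearMap.comp_apply]
    exact DFunLike.congr_fun hext ζ
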